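/- **Setting.** Let $\Lambda\subset\mathbb R^m$ be compact, let $\mu$ be a Borel probability measure on $\Lambda$, and let $\mathbb P=\mu^{\mathbb N}$ be the product measure on $\Omega=\Lambda^{\mathbb N}$. For $\lambda\in\Lambda$ let $\mathbb I_\lambda=\{f_1^\lambda,\dots,f_{N_\lambda}^\lambda\}$, $N_\lambda\ge1$, be a homogeneous iterated function system of similarities defined on a common non-empty open set $V\subset\mathbb R^d$: $|f_i^\lambda(x)-f_i^\lambda(y)|=c(\lambda)|x-y|$ for $x,y\in V$. Assume that $\lambda\mapsto N_\lambda$ and $\lambda\mapsto c(\lambda)$ are measurable, $\sup_\lambda N_\lambda<\infty$, $0<\inf_\lambda c(\lambda)\le\sup_\lambda c(\lambda)<1$, and that there is a non-empty compact set $\Delta\subset V$ with $f_i^\lambda(\Delta)\subseteq\Delta$ for all $\lambda,i$. Assume the uniform open set condition: there is a non-empty open set $U\subseteq V$ such that, for every $\lambda$, $f_i^\lambda(U)\subseteq U$ for all $i$ and the sets $f_1^\lambda(U),\dots,f_{N_\lambda}^\lambda(U)$ are pairwise disjoint. For $\omega\in\Omega$ put $$F_\omega=\bigcap_{k\ge1}\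 \bigcup_{\substack{1\le i_j\le N_{\omega_j}\\ 1\le j\le k}} f_{i_1}^{\omega_1}\circ\dots\circ f_{i_k}^{\omega_k}(\Delta),\qquad \mathfrak S_\lambda^t=\sum_{i=1}^{N_\lambda}c(\lambda)^t=N_\lambda c(\lambda)^t .$$ Let $N_r(X)$ be the least number of sets of radius at most $r$ needed to cover $X$. Let $\dim_B$ be the box-counting dimension (the common value of the lower and upper box-counting dimensions, when they agree) and $\dim_A$ the Assouad dimension. A *dimension function* is a real function $\phi$ of $x>0$ such that, for all sufficiently small $x>0$, $\phi(x)>0$ and both $\phi(x)$ and $\phi(x)|\log x|$ are monotone. The $\phi$-Assouad dimension $\dim_A^{\phi}F$ is the infimum of all $s$ for which there is $C>0$ with $$\sup_{x\in F}N_r(F\cap B(x,R))\le C\,(R/r)^s\qquad\text{whenever }0<r=R^{1+\phi(R)}<R<1 .$$ All asymptotic notation is as $x\to0^+$: $\varphi=o(\phi)$ means $\varphi/\phi\to0$, and $\varphi=\omega(\phi)$ means $\phi=o(\varphi)$. **Theorem.** 1. Let $\phi$ be a dimension function with $\sum_{k=1}^\infty e^{-\phi(e^{-k})k}<\infty$.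 Then, almost surely, for all dimension functions $\varphi=\omega(\phi)$, the box-counting dimension of $F_\omega$ exists and $\dim_A^{\varphi}F_\omega=\dim_B F_\omega$. 2. Let $\phi$ be a dimension function with $\sum_{k=1}^\infty e^{-\phi(e^{-k})k}=\infty$. Then, almost surely, $\dim_A^{\varphi}F_\omega=\dim_A F_\omega$ for all dimension functions $\varphi=o(\phi)$ with $\varphi(x)|\log x|\to\infty$ as $x\to0^+$. 3. There is a constant $s_A$ with $\dim_A F_\omega=s_A$ almost surely. If there is $\Lambda'\subset\Lambda$ with $\mu(\Lambda')>0$ and $\mathfrak S_\lambda^{s_A}=1$ for all $\lambda\in\Lambda'$, then there is a constant $C>0$ such that, for every dimension function $\phi$ with $\sum_{k=1}^\infty e^{-\phi(e^{-k})k}=\infty$, almost surely, $\dim_A^{\varphi}F_\omega=\dim_A F_\omega$ for all dimension functions $\varphi$ with $\varphi(x)|\log x|\to\infty$ as $x\to0^+$ and $\varphi(x)\le C\phi(x)$ for all sufficiently small $x>0$. -/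

import Mathlib

open MeasureTheory Filter Topology Asymptotics
open scoped NNReal ENNReal

noncomputable section

namespace OneVarRandom

/-! ### Dimensions of subsets of a metric space -/

section Dimensions

variable {X : Type*} [PseudoMetricSpace X]

/-- `N_r(A)`: the least number of sets of radius at most `r`, i.e. of subsets of closed balls of
radius `r`, needed to cover `A`, as an extended nonnegative real. -/
def coverNum (r : ℝ) (A : Set X) : ℝ≥0∞ :=
  ((Metric.externalCoveringNumber r.toNNReal A : ℕ∞) : ℝ≥0∞)

/-- `liminf_{r → 0} log N_r(A) / (-log r)`. -/
def lowerBoxDim (A : Set X) : EReal :=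
  liminf (fun r : ℝ => ENNReal.log (coverNum r A) / ((-Real.log r : ℝ) : EReal)) (𝓝[>] 0)

/-- `limsup_{r → 0} log N_r(A) / (-log r)`. -/
def upperBoxDim (A : Set X) : EReal :=
  limsup (fun r : ℝ => ENNReal.log (coverNum r A) / ((-Real.log r : ℝ) : EReal)) (𝓝[>] 0)

/-- The box-counting dimension of `A` exists and is equal to `t`. -/
def HasBoxDim (A : Set X) (t : EReal) : Prop :=
  lowerBoxDim A = t ∧ upperBoxDim A = t

/-- The Assouad dimension: the infimum of the exponents `s` for which there is `C > 0` with
`N_r(A ∩ B(x,R)) ≤ C (R/r)^s` for all `0 < r ≤ R < 1` and all `x ∈ A`. -/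
def assouadDim (A : Set X) : EReal :=
  sInf {t : EReal | ∃ s : ℝ, t = (s : EReal) ∧ ∃ C : ℝ, 0 < C ∧
    ∀ r R : ℝ, 0 < r → r ≤ R → R < 1 → ∀ x ∈ A,
      coverNum r (A ∩ Metric.closedBall x R) ≤ ENNReal.ofReal (C * (R / r) ^ s)}

/-- The generalised Assouad spectrum with respect to `φ` (the `φ`-Assouad dimension): the infimum
of the exponents `s` for which there is `C > 0` with `N_r(A ∩ B(x,R)) ≤ C (R/r)^s` for all
`0 < r = R^{1+φ(R)} < R < 1` and all `x ∈ A`. -/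
def phiAssouadDim (φ : ℝ → ℝ) (A : Set X) : EReal :=
  sInf {t : EReal | ∃ s : ℝ, t = (s : EReal) ∧ ∃ C : ℝ, 0 < C ∧
    ∀ r R : ℝ, 0 < r → r = R ^ (1 + φ R) → r < R → 0 < R → R < 1 → ∀ x ∈ A,
      coverNum r (A ∩ Metric.closedBall x R) ≤ ENNReal.ofReal (C * (R / r) ^ s)}

end Dimensions

/-- `φ` is a dimension function: `φ(x) > 0`, and `φ(x)` and `φ(x) |log x|` are monotone (each of
them non-decreasing or non-increasing). This is only asked for all sufficiently small `x > 0`, so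
that `log |log x| / |log x|` is an example. -/
def IsDimensionFunction (φ : ℝ → ℝ) : Prop :=
  ∃ δ : ℝ, 0 < δ ∧ δ ≤ 1 ∧ (∀ x ∈ Set.Ioo 0 δ, 0 < φ x) ∧
    (MonotoneOn φ (Set.Ioo 0 δ) ∨ AntitoneOn φ (Set.Ioo 0 δ)) ∧
    (MonotoneOn (fun x => φ x * |Real.log x|) (Set.Ioo 0 δ) ∨
      AntitoneOn (fun x => φ x * |Real.log x|) (Set.Ioo 0 δ))

/-- `∑_{k ≥ 1} exp (-φ(e^{-k}) k) < ∞` (the terms are positive). -/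
def SumConverges (φ : ℝ → ℝ) : Prop :=
  Summable fun k : ℕ => Real.exp (-(φ (Real.exp (-((k + 1 : ℕ) : ℝ))) * ((k + 1 : ℕ) : ℝ)))

/-! ### One-variable random homogeneous self-similar sets -/

/-- A family of homogeneous self-similar iterated function systems
`{f^l_1, …, f^l_{N l}}` on `ℝ^d`, indexed by the points `l` of a measurable space `Λ`.
The map `f l i` is only relevant on the open set `V`, where it is a similarity of ratio `c l`. -/
structure HomogeneousFamily (Λ : Type*) [MeasurableSpace Λ] (d : ℕ) where
  /-- the number of maps -/
  N : Λ → ℕ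
  /-- the common contraction ratio -/
  c : Λ → ℝ
  /-- the maps -/
  f : (l : Λ) → Fin (N l) → EuclideanSpace ℝ (Fin d) → EuclideanSpace ℝ (Fin d)
  /-- the open set on which the maps are defined -/
  V : Set (EuclideanSpace ℝ (Fin d))
  /-- the compact set from which the attractors are built -/
  Δ : Set (EuclideanSpace ℝ (Fin d))
  measurable_N : Measurable N
  measurable_c : Measurable c
  N_pos : ∀ l, 1 ≤ N l
  N_bdd : ∃ M : ℕ, ∀ l, N l ≤ M
  c_bdd : ∃ a b : ℝ, 0 < a ∧ b < 1 ∧ ∀ l, a ≤ c l ∧ c l ≤ b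
  isOpen_V : IsOpen V
  nonempty_V : V.Nonempty
  similarity : ∀ l i, ∀ x ∈ V, ∀ y ∈ V, dist (f l i x) (f l i y) = c l * dist x y
  isCompact_Δ : IsCompact Δ
  nonempty_Δ : Δ.Nonempty
  Δ_subset_V : Δ ⊆ V
  mapsTo_Δ : ∀ l i, f l i '' Δ ⊆ Δ

namespace HomogeneousFamily

variable {Λ : Type*} [MeasurableSpace Λ] {d : ℕ} (S : HomogeneousFamily Λ d)

/-- The uniform open set condition. -/
def UniformOSC : Prop :=
  ∃ U : Set (EuclideanSpace ℝ (Fin d)), IsOpen U ∧ U.Nonempty ∧ U ⊆ S.V ∧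
    (∀ l i, S.f l i '' U ⊆ U) ∧
    ∀ l i j, i ≠ j → Disjoint (S.f l i '' U) (S.f l j '' U)

/-- `𝔖_l^t = ∑_i (c_i^l)^t`. -/
def ratioSum (l : Λ) (t : ℝ) : ℝ := ∑ _i : Fin (S.N l), S.c l ^ t

/-- `f^{ω_1}_{i_1} ∘ ⋯ ∘ f^{ω_k}_{i_k}`, where `ω_j`, `i_j` are written `ω (j - 1)`, `i (j - 1)`. -/
def wordMap (ω : ℕ → Λ) (i : (j : ℕ) → Fin (S.N (ω j))) :
    ℕ → EuclideanSpace ℝ (Fin d) → EuclideanSpace ℝ (Fin d)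
  | 0 => id
  | k + 1 => wordMap ω i k ∘ S.f (ω k) (i k)

/-- The attractor `F_ω = ⋂_{k ≥ 1} ⋃_{i_1, …, i_k} f^{ω_1}_{i_1} ∘ ⋯ ∘ f^{ω_k}_{i_k} (Δ)`. (Every
finite word is the beginning of an infinite one, as all `N l` are positive.) -/
def attractor (ω : ℕ → Λ) : Set (EuclideanSpace ℝ (Fin d)) :=
  ⋂ k : ℕ, ⋃ i : (j : ℕ) → Fin (S.N (ω j)), S.wordMap ω i (k + 1) '' S.Δ

end HomogeneousFamily

end OneVarRandom

end

noncomputable section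

namespace OneVarRandom

/-! ### Similarities and Hausdorff measure -/

/-! Under the open set condition boundedly many cylinders of size comparable to R meet a ball of
radius R. So if R and r are comparable to the contraction ratios of levels n ≤ q, covering the part
of `F_ω` in a ball of radius R at scale r takes about `numProd ω q / numProd ω n` sets
(`exists_coverNum_bounds`). Comparing this count with (R/r)^s is a question about the sign of the
sum of log 𝔖^s over the window of levels n, …, q - 1, a sum of bounded i.i.d. variables. For r =
R^{1+ψ(R)} the window has length comparable to y = ψ(R)|log R|, and n is comparable to |log R|.

Everything thus depends on y against log n. Windows longer than K log n all behave like the mean, by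
Hoeffding's inequality and Borel–Cantelli (`exists_ae_eventually_window_sum_neg`); the resulting
exponent is the box dimension. Windows shorter than a small multiple of log n can be placed inside
runs of parameters from a set of positive measure on which 𝔖^s ≥ 1 (`exists_ae_eventually_run`); the
resulting exponent is the essential supremum of the similarity dimensions, which is the Assouad
dimension.

The series enters only through monotonicity of φ(x)|log x|: convergence forces φ(x)|log x| ≥ ½
log|log x| near 0 (`eventually_log_abs_log_le`), while divergence gives φ(e^{-k})k ≤ 2 log k for
infinitely many k (`IsDimensionFunction.frequently_le_log`). The o and ω conditions absorb all
constants. If the essential supremum is attained on a set of positive measure, one run constant is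
enough. The null sets come from windows and runs alone, so they serve all dimension functions at
once. -/

theorem hausdorffMeasure_le_image_of_dist_eq {X Y : Type*} [MetricSpace X] [MeasurableSpace X]
    [BorelSpace X] [MetricSpace Y] [MeasurableSpace Y] [BorelSpace Y]
    {f : X → Y} {c : ℝ} (hc : 0 < c) {K : Set X} {s : ℝ} (hs : 0 ≤ s)
    (h : ∀ x ∈ K, ∀ y ∈ K, dist (f x) (f y) = c * dist x y) :
    ENNReal.ofReal (c ^ s) * μH[s] K ≤ μH[s] (f '' K) := by
  rcases K.eq_empty_or_nonempty with rfl | ⟨x₀, hx₀⟩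
  · simp
  have : Nonempty X := ⟨x₀⟩
  have hinj : Set.InjOn f K := by
    intro x hx y hy hxy
    have := h x hx y hy
    rw [hxy, dist_self] at this
    rcases mul_eq_zero.mp this.symm with h0 | h0
    · exact absurd h0 hc.ne'
    · exact dist_eq_zero.mp h0
  -- The inverse on the image is c⁻¹-Lipschitz, so it enlarges the measure by at most c^{-s}.
  have hg : LipschitzOnWith (c⁻¹).toNNReal (Function.invFunOn f K) (f '' K) := by
    refine LipschitzOnWith.of_dist_le_mul ?_
    rintro _ ⟨x, hx, rfl⟩ _ ⟨y, hy, rfl⟩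
    rw [hinj.leftInvOn_invFunOn hx, hinj.leftInvOn_invFunOn hy, h x hx y hy,
      Real.coe_toNNReal _ (inv_nonneg.mpr hc.le), ← mul_assoc, inv_mul_cancel₀ hc.ne', one_mul]
  have himg : Function.invFunOn f K '' (f '' K) = K := by
    rw [Set.image_image]
    conv_rhs => rw [← Set.image_id K]
    exact Set.image_congr fun x hx => hinj.leftInvOn_invFunOn hx
  have key := hg.hausdorffMeasure_image_le hs
  rw [himg] at key
  calc ENNReal.ofReal (c ^ s) * μH[s] K
      ≤ ENNReal.ofReal (c ^ s) * (((c⁻¹).toNNReal : ℝ≥0∞) ^ s * μH[s] (f '' K)) := by gcongr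
    _ = μH[s] (f '' K) := by
        rw [← mul_assoc, ← ENNReal.ofReal, ENNReal.ofReal_rpow_of_pos (inv_pos.mpr hc),
          ← ENNReal.ofReal_mul (by positivity), ← Real.mul_rpow hc.le (inv_nonneg.mpr hc.le),
          mul_inv_cancel₀ hc.ne', Real.one_rpow, ENNReal.ofReal_one, one_mul]

/-! ### Covering numbers -/

section Cover

variable {X : Type*} [PseudoMetricSpace X]

theorem coverNum_mono {r : ℝ} {A B : Set X} (h : A ⊆ B) : coverNum r A ≤ coverNum r B := by
  unfold coverNum
  exact_mod_cast Metric.externalCoveringNumber_mono_set h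

theorem coverNum_le_card {r : ℝ} (hr : 0 ≤ r) {A : Set X} {C : Finset X}
    (h : ∀ x ∈ A, ∃ y ∈ C, dist x y ≤ r) : coverNum r A ≤ C.card := by
  have hC : Metric.IsCover r.toNNReal A (C : Set X) := by
    rw [Metric.isCover_iff_subset_iUnion_closedBall]
    intro x hx
    obtain ⟨y, hy, hxy⟩ := h x hx
    simp only [Set.mem_iUnion]
    exact ⟨y, hy, by rwa [Metric.mem_closedBall, Real.coe_toNNReal _ hr]⟩
  have := hC.externalCoveringNumber_le_encard
  rw [Set.encard_coe_eq_coe_finsetCard] at this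
  unfold coverNum
  calc ((Metric.externalCoveringNumber r.toNNReal A : ℕ∞) : ℝ≥0∞) ≤ ((C.card : ℕ∞) : ℝ≥0∞) := by
        exact_mod_cast this
    _ = C.card := by simp

theorem le_coverNum {r : ℝ} (hr : 0 ≤ r) {A : Set X} {t : ℝ≥0∞}
    (h : ∀ C : Finset X, (∀ x ∈ A, ∃ y ∈ C, dist x y ≤ r) → t ≤ C.card) : t ≤ coverNum r A := by
  obtain ⟨C, hC, hcard⟩ : ∃ C : Set X, Metric.IsCover r.toNNReal A C ∧
      Metric.externalCoveringNumber r.toNNReal A = C.encard := by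
    have hne : Nonempty {C : Set X // Metric.IsCover r.toNNReal A C} :=
      ⟨⟨A, Metric.IsCover.rfl⟩⟩
    obtain ⟨C, hC⟩ := ENat.exists_eq_iInf
      (fun C : {C : Set X // Metric.IsCover r.toNNReal A C} => C.1.encard)
    exact ⟨C.1, C.2, by rw [Metric.externalCoveringNumber, hC, iInf_subtype]⟩
  unfold coverNum
  rw [hcard]
  by_cases hfin : C.Finite
  · rw [hfin.encard_eq_coe_toFinset_card]
    refine (h hfin.toFinset fun x hx => ?_).trans (by simp)
    rw [Metric.isCover_iff_subset_iUnion_closedBall] at hC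
    have := hC hx
    simp only [Set.mem_iUnion] at this
    obtain ⟨y, hy, hxy⟩ := this
    exact ⟨y, by simpa using hy, by rwa [Metric.mem_closedBall, Real.coe_toNNReal _ hr] at hxy⟩
  · rw [Set.encard_eq_top_iff.mpr hfin]
    simp

end Cover

/-! ### Cylinder ratios and counts. -/

namespace HomogeneousFamily

variable {Λ : Type*} [MeasurableSpace Λ] {d : ℕ} (S : HomogeneousFamily Λ d)

/-- The contraction ratio of the cylinders of level `n`. -/
def ratioProd (ω : ℕ → Λ) (n : ℕ) : ℝ := ∏ j ∈ Finset.range n, S.c (ω j)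

/-- The number of cylinders of level `n`. -/
def numProd (ω : ℕ → Λ) (n : ℕ) : ℕ := ∏ j ∈ Finset.range n, S.N (ω j)

theorem c_pos (l : Λ) : 0 < S.c l := by
  obtain ⟨a, b, ha, -, h⟩ := S.c_bdd
  exact ha.trans_le (h l).1

theorem ratioProd_pos (ω : ℕ → Λ) (n : ℕ) : 0 < S.ratioProd ω n :=
  Finset.prod_pos fun _ _ => S.c_pos _

theorem ratioProd_zero (ω : ℕ → Λ) : S.ratioProd ω 0 = 1 := Finset.prod_range_zero _

theorem ratioProd_succ (ω : ℕ → Λ) (n : ℕ) :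
    S.ratioProd ω (n + 1) = S.ratioProd ω n * S.c (ω n) := Finset.prod_range_succ _ _

theorem numProd_pos (ω : ℕ → Λ) (n : ℕ) : 0 < S.numProd ω n :=
  Finset.prod_pos fun _ _ => S.N_pos _

theorem numProd_zero (ω : ℕ → Λ) : S.numProd ω 0 = 1 := Finset.prod_range_zero _

theorem numProd_succ (ω : ℕ → Λ) (n : ℕ) :
    S.numProd ω (n + 1) = S.numProd ω n * S.N (ω n) := Finset.prod_range_succ _ _

/-! ### Cylinders -/

variable {S} {ω : ℕ → Λ}

theorem wordMap_congr {i i' : (j : ℕ) → Fin (S.N (ω j))} {k : ℕ} (h : ∀ j < k, i j = i' j) :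
    S.wordMap ω i k = S.wordMap ω i' k := by
  induction k with
  | zero => rfl
  | succ k ih =>
    simp only [wordMap]
    rw [ih fun j hj => h j (by omega), h k (by omega)]

theorem image_wordMap_succ_subset {E : Set (EuclideanSpace ℝ (Fin d))}
    (hE : ∀ l i, S.f l i '' E ⊆ E) (i : (j : ℕ) → Fin (S.N (ω j))) (k : ℕ) :
    S.wordMap ω i (k + 1) '' E ⊆ S.wordMap ω i k '' E := by
  simp only [wordMap]
  rw [Set.image_comp]
  exact Set.image_mono (hE _ _)

theorem image_wordMap_antitone {E : Set (EuclideanSpace ℝ (Fin d))}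
    (hE : ∀ l i, S.f l i '' E ⊆ E) (i : (j : ℕ) → Fin (S.N (ω j))) :
    Antitone fun k => S.wordMap ω i k '' E :=
  antitone_nat_of_succ_le fun k => image_wordMap_succ_subset hE i k

theorem dist_wordMap {E : Set (EuclideanSpace ℝ (Fin d))} (hEV : E ⊆ S.V)
    (hE : ∀ l i, S.f l i '' E ⊆ E) (i : (j : ℕ) → Fin (S.N (ω j))) (k : ℕ)
    {x y : EuclideanSpace ℝ (Fin d)} (hx : x ∈ E) (hy : y ∈ E) :
    dist (S.wordMap ω i k x) (S.wordMap ω i k y) = S.ratioProd ω k * dist x y := by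
  induction k generalizing x y with
  | zero => simp [wordMap, ratioProd]
  | succ k ih =>
    simp only [wordMap, Function.comp]
    rw [ih (hE _ _ ⟨x, hx, rfl⟩) (hE _ _ ⟨y, hy, rfl⟩), S.similarity _ _ x (hEV hx) y (hEV hy),
      ratioProd_succ, mul_assoc]

theorem disjoint_wordMap {U : Set (EuclideanSpace ℝ (Fin d))} (hUV : U ⊆ S.V)
    (hU : ∀ l i, S.f l i '' U ⊆ U)
    (hdisj : ∀ l i j, i ≠ j → Disjoint (S.f l i '' U) (S.f l j '' U))
    {i i' : (j : ℕ) → Fin (S.N (ω j))} {k : ℕ} (h : ∃ j < k, i j ≠ i' j) :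
    Disjoint (S.wordMap ω i k '' U) (S.wordMap ω i' k '' U) := by
  induction k with
  | zero => simp at h
  | succ k ih =>
    by_cases h' : ∃ j < k, i j ≠ i' j
    · exact (ih h').mono (image_wordMap_succ_subset hU i k) (image_wordMap_succ_subset hU i' k)
    · push Not at h'
      obtain ⟨j, hj, hne⟩ := h
      obtain rfl : j = k := by
        by_contra hjk
        exact hne (h' j (by omega))
      rw [Set.disjoint_left]
      rintro _ ⟨x, hx, rfl⟩ ⟨y, hy, hxy⟩
      simp only [wordMap, Function.comp, ← wordMap_congr h'] at hxy
      have hfx := hU _ (i j) ⟨x, hx, rfl⟩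
      have hfy := hU _ (i' j) ⟨y, hy, rfl⟩
      have hd := dist_wordMap hUV hU i j hfy hfx
      rw [hxy, dist_self] at hd
      rcases mul_eq_zero.mp hd.symm with h0 | h0
      · exact (S.ratioProd_pos ω j).ne' h0
      · exact Set.disjoint_left.mp (hdisj _ _ _ hne) ⟨x, hx, rfl⟩
          ⟨y, hy, dist_eq_zero.mp h0⟩

/-- Words of length q are represented by infinite words, so `T` is a transversal: one representative
for each length-q extension of the first n letters of `i`. -/
theorem exists_words (ω : ℕ → Λ) (i : (j : ℕ) → Fin (S.N (ω j))) {n q : ℕ} (hnq : n ≤ q) :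
    ∃ T : Finset ((j : ℕ) → Fin (S.N (ω j))),
      (∀ v ∈ T, ∀ j < n, v j = i j) ∧ T.card * S.numProd ω n = S.numProd ω q ∧
      (∀ v ∈ T, ∀ v' ∈ T, v ≠ v' → ∃ j < q, v j ≠ v' j) ∧
      ∀ v : (j : ℕ) → Fin (S.N (ω j)), (∀ j < n, v j = i j) → ∃ v' ∈ T, ∀ j < q, v' j = v j := by
  classical
  induction q, hnq using Nat.le_induction with
  | base =>
    refine ⟨{i}, by simp, by simp, ?_, fun v hv => ⟨i, by simp, fun j hj => (hv j hj).symm⟩⟩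
    intro v hv v' hv' hne
    rw [Finset.mem_singleton] at hv hv'
    exact absurd (hv.trans hv'.symm) hne
  | succ q hnq ih =>
    obtain ⟨T, h1, h2, h3, h4⟩ := ih
    refine ⟨(T ×ˢ (Finset.univ : Finset (Fin (S.N (ω q))))).image
      fun p => Function.update p.1 q p.2, ?_, ?_, ?_, ?_⟩
    · intro v hv j hj
      obtain ⟨⟨w, a⟩, hw, rfl⟩ := Finset.mem_image.mp hv
      rw [Function.update_of_ne (by omega)]
      exact h1 w (Finset.mem_product.mp hw).1 j hj
    · rw [Finset.card_image_of_injOn, Finset.card_product, numProd_succ, ← h2, Finset.card_univ,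
        Fintype.card_fin]
      · ring
      · rintro ⟨w, a⟩ hw ⟨w', a'⟩ hw' heq
        have hw := (Finset.mem_product.mp hw).1
        have hw' := (Finset.mem_product.mp hw').1
        simp only at heq hw hw'
        have ha : a = a' := by simpa using congrFun heq q
        have hww : w = w' := by
          by_contra hne
          obtain ⟨j, hj, hjne⟩ := h3 w hw w' hw' hne
          have := congrFun heq j
          rw [Function.update_of_ne (by omega), Function.update_of_ne (by omega)] at this
          exact hjne this
        rw [ha, hww]
    · intro v hv v' hv' hne
      obtain ⟨⟨w, a⟩, hw, rfl⟩ := Finset.mem_image.mp hv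
      obtain ⟨⟨w', a'⟩, hw', rfl⟩ := Finset.mem_image.mp hv'
      have hw := (Finset.mem_product.mp hw).1
      have hw' := (Finset.mem_product.mp hw').1
      by_cases hww : w = w'
      · subst hww
        refine ⟨q, by omega, ?_⟩
        simp only [Function.update_self]
        rintro rfl
        exact hne rfl
      · obtain ⟨j, hj, hjne⟩ := h3 w hw w' hw' hww
        refine ⟨j, by omega, ?_⟩
        simpa only [Function.update_of_ne (show j ≠ q by omega)] using hjne
    · intro v hv
      obtain ⟨w, hw, hwv⟩ := h4 v hv
      refine ⟨Function.update w q (v q), Finset.mem_image.mpr ⟨(w, v q), by simp [hw], rfl⟩, ?_⟩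
      intro j hj
      rcases Nat.lt_succ_iff_lt_or_eq.mp hj with hj | rfl
      · rw [Function.update_of_ne (by omega), hwv j hj]
      · simp

variable (S)

/-- Volume comparison: each cylinder counted comes with a copy of a fixed ball in U scaled by the
ratio. By the open set condition these copies are disjoint, and all lie in one ball of comparable
radius. -/
theorem exists_card_cylinders_le (hS : S.UniformOSC) : ∃ A : ℝ, 1 ≤ A ∧
    ∀ (ω : ℕ → Λ) (k : ℕ) (y : EuclideanSpace ℝ (Fin d)) (r : ℝ), r ≤ S.ratioProd ω k →
      ∀ T : Finset ((j : ℕ) → Fin (S.N (ω j))),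
        (∀ v ∈ T, ∀ v' ∈ T, v ≠ v' → ∃ j < k, v j ≠ v' j) →
        (∀ v ∈ T, (S.wordMap ω v k '' S.Δ ∩ Metric.closedBall y r).Nonempty) →
        (T.card : ℝ) ≤ A := by
  obtain ⟨U, hUo, ⟨z, hz⟩, hUV, hU, hdisj⟩ := hS
  obtain ⟨ρ, hρ, hball⟩ := Metric.nhds_basis_closedBall.mem_iff.mp (hUo.mem_nhds hz)
  set K := Metric.closedBall z ρ with hK
  -- U and Δ need not meet. Their union is forward invariant, so compositions are similarities on it
  -- and control distances from the ball in U to Δ.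
  have hEV : U ∪ S.Δ ⊆ S.V := Set.union_subset hUV S.Δ_subset_V
  have hE : ∀ l i, S.f l i '' (U ∪ S.Δ) ⊆ U ∪ S.Δ := fun l i => by
    rw [Set.image_union]
    exact Set.union_subset_union (hU l i) (S.mapsTo_Δ l i)
  obtain ⟨D, hD⟩ : ∃ D : ℝ, ∀ x ∈ K, ∀ y ∈ S.Δ, dist x y ≤ D := by
    have hb : Bornology.IsBounded (K ∪ S.Δ) :=
      Metric.isBounded_closedBall.union S.isCompact_Δ.isBounded
    obtain ⟨D, hD⟩ := Metric.isBounded_iff.mp hb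
    exact ⟨D, fun x hx y hy => hD (Or.inl hx) (Or.inr hy)⟩
  obtain ⟨δ₀, hδ₀⟩ := S.nonempty_Δ
  have hD0 : 0 ≤ D := dist_nonneg.trans (hD z (Metric.mem_closedBall_self hρ.le) δ₀ hδ₀)
  set m : Measure (EuclideanSpace ℝ (Fin d)) := μH[(d : ℝ)] with hm
  have hHaar : m.IsAddHaarMeasure := by
    simpa using MeasureTheory.isAddHaarMeasure_hausdorffMeasure (E := EuclideanSpace ℝ (Fin d))
  have hB0 : m (Metric.ball 0 1) ≠ 0 := (Metric.measure_ball_pos m _ one_pos).ne'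
  have hBt : m (Metric.ball 0 1) ≠ ⊤ := measure_ball_lt_top.ne
  refine ⟨max 1 ((D + 1) ^ d / ρ ^ d), le_max_left _ _, fun ω k y r hr T hT hTn => ?_⟩
  refine le_trans ?_ (le_max_right _ _)
  set c := S.ratioProd ω k with hc
  have hcpos : 0 < c := S.ratioProd_pos ω k
  have hsub : ∀ v ∈ T, S.wordMap ω v k '' K ⊆ Metric.closedBall y (c * (D + 1)) := by
    rintro v hv _ ⟨x, hx, rfl⟩
    obtain ⟨_, ⟨p, hp, rfl⟩, hpy⟩ := hTn v hv
    rw [Metric.mem_closedBall] at hpy ⊢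
    calc dist (S.wordMap ω v k x) y
        ≤ dist (S.wordMap ω v k x) (S.wordMap ω v k p) + dist (S.wordMap ω v k p) y :=
          dist_triangle _ _ _
      _ ≤ c * D + c := by
          rw [dist_wordMap hEV hE v k (Or.inl (hball hx)) (Or.inr hp)]
          gcongr
          · exact hD x hx p hp
          · exact hpy.trans hr
      _ = c * (D + 1) := by ring
  have hcont : ∀ v, ContinuousOn (S.wordMap ω v k) K := fun v => by
    have : LipschitzOnWith c.toNNReal (S.wordMap ω v k) K :=
      LipschitzOnWith.of_dist_le_mul fun x hx y hy => by
        rw [dist_wordMap hEV hE v k (Or.inl (hball hx)) (Or.inl (hball hy)),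
          Real.coe_toNNReal _ hcpos.le]
    exact this.continuousOn
  have hmeas : ∀ v ∈ T, MeasurableSet (S.wordMap ω v k '' K) := fun v _ =>
    ((isCompact_closedBall z ρ).image_of_continuousOn (hcont v)).isClosed.measurableSet
  have hpd : Set.PairwiseDisjoint (T : Set ((j : ℕ) → Fin (S.N (ω j))))
      fun v => S.wordMap ω v k '' K := fun v hv v' hv' hne =>
    (disjoint_wordMap hUV hU hdisj (hT v hv v' hv' hne)).mono
      (Set.image_mono hball) (Set.image_mono hball)
  have hfin : Module.finrank ℝ (EuclideanSpace ℝ (Fin d)) = d := by simp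
  have h1 : ∀ v ∈ T, ENNReal.ofReal (c ^ d * ρ ^ d) * m (Metric.ball 0 1) ≤
      m (S.wordMap ω v k '' K) := fun v _ => by
    have := hausdorffMeasure_le_image_of_dist_eq hcpos (K := K) (s := d) (by positivity)
      (fun x hx y hy => dist_wordMap hEV hE v k (Or.inl (hball hx)) (Or.inl (hball hy)))
    rw [← hm, hK, Measure.addHaar_closedBall m z hρ.le, hfin, Real.rpow_natCast, ← mul_assoc,
      ← ENNReal.ofReal_mul (by positivity)] at this
    exact this
  have h2 : (T.card : ℝ≥0∞) * (ENNReal.ofReal (c ^ d * ρ ^ d) * m (Metric.ball 0 1)) ≤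
      ENNReal.ofReal ((c * (D + 1)) ^ d) * m (Metric.ball 0 1) := by
    calc (T.card : ℝ≥0∞) * (ENNReal.ofReal (c ^ d * ρ ^ d) * m (Metric.ball 0 1))
        = ∑ v ∈ T, ENNReal.ofReal (c ^ d * ρ ^ d) * m (Metric.ball 0 1) := by simp
      _ ≤ ∑ v ∈ T, m (S.wordMap ω v k '' K) := Finset.sum_le_sum h1
      _ = m (⋃ v ∈ T, S.wordMap ω v k '' K) := (measure_biUnion_finset hpd hmeas).symm
      _ ≤ m (Metric.closedBall y (c * (D + 1))) := measure_mono (Set.iUnion₂_subset hsub)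
      _ = _ := by rw [Measure.addHaar_closedBall m y (by positivity), hfin]
  rw [← mul_assoc, ENNReal.mul_le_mul_iff_left hB0 hBt, ← ENNReal.ofReal_natCast,
    ← ENNReal.ofReal_mul (by positivity), ENNReal.ofReal_le_ofReal_iff (by positivity)] at h2
  rw [le_div_iff₀ (by positivity)]
  rw [mul_pow] at h2
  have hcd : 0 < c ^ d := by positivity
  nlinarith

end HomogeneousFamily

/-! ### Covering numbers of the attractor in terms of cylinder counts. -/

namespace HomogeneousFamily

variable {Λ : Type*} [MeasurableSpace Λ] {d : ℕ} (S : HomogeneousFamily Λ d)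

variable {S} in
theorem exists_mem_attractor {ω : ℕ → Λ} (i : (j : ℕ) → Fin (S.N (ω j))) :
    ∃ x ∈ S.attractor ω, ∀ k, x ∈ S.wordMap ω i k '' S.Δ := by
  have hcomp : ∀ k, IsCompact (S.wordMap ω i k '' S.Δ) := fun k => by
    refine S.isCompact_Δ.image_of_continuousOn ?_
    have : LipschitzOnWith (S.ratioProd ω k).toNNReal (S.wordMap ω i k) S.Δ :=
      LipschitzOnWith.of_dist_le_mul fun x hx y hy => by
        rw [dist_wordMap S.Δ_subset_V S.mapsTo_Δ i k hx hy,
          Real.coe_toNNReal _ (S.ratioProd_pos ω k).le]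
    exact this.continuousOn
  obtain ⟨x, hx⟩ := IsCompact.nonempty_iInter_of_sequence_nonempty_isCompact_isClosed
    (fun k => S.wordMap ω i k '' S.Δ) (fun k => image_wordMap_succ_subset S.mapsTo_Δ i k)
    (fun k => S.nonempty_Δ.image _) (hcomp 0) (fun k => (hcomp k).isClosed)
  rw [Set.mem_iInter] at hx
  exact ⟨x, Set.mem_iInter.mpr fun k => Set.mem_iUnion.mpr ⟨i, hx (k + 1)⟩, hx⟩

variable {S} in
theorem exists_word_of_mem_attractor {ω : ℕ → Λ} {x : EuclideanSpace ℝ (Fin d)}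
    (hx : x ∈ S.attractor ω) (k : ℕ) :
    ∃ i : (j : ℕ) → Fin (S.N (ω j)), x ∈ S.wordMap ω i k '' S.Δ := by
  obtain ⟨i, hi⟩ := Set.mem_iUnion.mp (Set.mem_iInter.mp hx k)
  exact ⟨i, image_wordMap_succ_subset S.mapsTo_Δ i k hi⟩

theorem attractor_nonempty (ω : ℕ → Λ) : (S.attractor ω).Nonempty := by
  obtain ⟨x, hx, -⟩ := exists_mem_attractor (S := S) (ω := ω) fun j => ⟨0, S.N_pos _⟩
  exact ⟨x, hx⟩

/-- Upper bound: at most A cylinders of level n meet the ball, and each splits into `numProd ω q /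
numProd ω n` pieces of diameter at most r. Lower bound: the level-n cylinder through x lies in the
ball, and an r-ball reaches at most A of its level-q pieces. -/
theorem exists_coverNum_bounds (hS : S.UniformOSC) : ∃ A D : ℝ, 1 ≤ A ∧ 1 ≤ D ∧
    (∀ (ω : ℕ → Λ) (n q : ℕ), n ≤ q → ∀ (x : EuclideanSpace ℝ (Fin d)) (R r : ℝ),
      R ≤ S.ratioProd ω n → D * S.ratioProd ω q ≤ r →
      coverNum r (S.attractor ω ∩ Metric.closedBall x R) ≤
        ENNReal.ofReal (A * (S.numProd ω q / S.numProd ω n))) ∧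
    (∀ (ω : ℕ → Λ) (n q : ℕ), n ≤ q → ∀ x ∈ S.attractor ω, ∀ R r : ℝ,
      D * S.ratioProd ω n ≤ R → 0 ≤ r → r ≤ S.ratioProd ω q →
      ENNReal.ofReal (S.numProd ω q / S.numProd ω n / A) ≤
        coverNum r (S.attractor ω ∩ Metric.closedBall x R)) ∧
    (∀ (ω : ℕ → Λ) (q : ℕ) (r : ℝ), D * S.ratioProd ω q ≤ r →
      coverNum r (S.attractor ω) ≤ ENNReal.ofReal (S.numProd ω q)) := by
  classical
  obtain ⟨A, hA, hcard⟩ := S.exists_card_cylinders_le hS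
  obtain ⟨D', hD'⟩ := Metric.isBounded_iff.mp S.isCompact_Δ.isBounded
  obtain ⟨δ₀, hδ₀⟩ := S.nonempty_Δ
  have hdist : ∀ x ∈ S.Δ, ∀ y ∈ S.Δ, dist x y ≤ max 1 D' := fun x hx y hy =>
    (hD' hx hy).trans (le_max_right _ _)
  have hcyl : ∀ (ω : ℕ → Λ) (i : (j : ℕ) → Fin (S.N (ω j))) (k : ℕ),
      ∀ x ∈ S.wordMap ω i k '' S.Δ, ∀ y ∈ S.wordMap ω i k '' S.Δ,
        dist x y ≤ max 1 D' * S.ratioProd ω k := by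
    rintro ω i k _ ⟨x, hx, rfl⟩ _ ⟨y, hy, rfl⟩
    rw [dist_wordMap S.Δ_subset_V S.mapsTo_Δ i k hx hy, mul_comm]
    have := S.ratioProd_pos ω k
    gcongr
    exact hdist x hx y hy
  have hD1 : (1 : ℝ) ≤ max 1 D' := le_max_left _ _
  have hN : ∀ (ω : ℕ → Λ) (n : ℕ), (0 : ℝ) < S.numProd ω n := fun ω n => by
    exact_mod_cast S.numProd_pos ω n
  refine ⟨A, max 1 D', hA, hD1, ?_, ?_, ?_⟩
  · intro ω n q hnq x R r hR hr
    have hr0 : 0 ≤ r := le_trans (by have := S.ratioProd_pos ω q; positivity) hr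
    obtain ⟨T, -, -, hT, hT'⟩ := exists_words (S := S) ω (fun j => ⟨0, S.N_pos _⟩) (Nat.zero_le n)
    choose W hW1 hW2 hW3 hW4 using
      fun w : (j : ℕ) → Fin (S.N (ω j)) => exists_words (S := S) ω w hnq
    set T₀ := T.filter fun w => (S.wordMap ω w n '' S.Δ ∩ Metric.closedBall x R).Nonempty with hT₀
    have hT₀card : (T₀.card : ℝ) ≤ A := hcard ω n x R hR T₀
      (fun v hv v' hv' => hT v (Finset.mem_filter.mp hv).1 v' (Finset.mem_filter.mp hv').1)
      fun v hv => (Finset.mem_filter.mp hv).2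
    have hcov := coverNum_le_card hr0 (A := S.attractor ω ∩ Metric.closedBall x R)
      (C := T₀.biUnion fun w => (W w).image fun v => S.wordMap ω v q δ₀) (by
        rintro y ⟨hy, hyR⟩
        obtain ⟨v, hv⟩ := exists_word_of_mem_attractor hy q
        obtain ⟨w, hw, hwv⟩ := hT' v (by simp)
        obtain ⟨v', hv', hvv'⟩ := hW4 w v fun j hj => (hwv j hj).symm
        refine ⟨S.wordMap ω v' q δ₀, Finset.mem_biUnion.mpr ⟨w, Finset.mem_filter.mpr ⟨hw, y, ?_, hyR⟩,
          Finset.mem_image.mpr ⟨v', hv', rfl⟩⟩, ?_⟩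
        · rw [wordMap_congr hwv]
          exact image_wordMap_antitone S.mapsTo_Δ v hnq hv
        · refine (hcyl ω v' q y ?_ _ ⟨δ₀, hδ₀, rfl⟩).trans hr
          rwa [wordMap_congr hvv'])
    refine hcov.trans ?_
    rw [← ENNReal.ofReal_natCast]
    refine ENNReal.ofReal_le_ofReal ?_
    calc ((T₀.biUnion fun w => (W w).image fun v => S.wordMap ω v q δ₀).card : ℝ)
        ≤ ∑ w ∈ T₀, ((W w).card : ℝ) := by
          exact_mod_cast Finset.card_biUnion_le.trans
            (Finset.sum_le_sum fun w _ => Finset.card_image_le)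
      _ = ∑ w ∈ T₀, ((S.numProd ω q : ℝ) / S.numProd ω n) := by
          refine Finset.sum_congr rfl fun w _ => ?_
          rw [eq_div_iff (hN ω n).ne']
          exact_mod_cast hW2 w
      _ ≤ _ := by
          rw [Finset.sum_const, nsmul_eq_mul]
          gcongr
  · intro ω n q hnq x hx R r hR hr0 hr
    obtain ⟨i, hi⟩ := exists_word_of_mem_attractor hx n
    obtain ⟨T, hT1, hT2, hT3, -⟩ := exists_words (S := S) ω i hnq
    choose p hp1 hp2 using fun v : (j : ℕ) → Fin (S.N (ω j)) => exists_mem_attractor v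
    refine le_coverNum hr0 fun C hC => ?_
    have hpC : ∀ v, ∃ y, v ∈ T → y ∈ C ∧ dist (p v) y ≤ r := fun v => by
      by_cases hv : v ∈ T
      · obtain ⟨y, hy, hy'⟩ := hC (p v) ⟨hp1 v, by
          rw [Metric.mem_closedBall]
          refine (hcyl ω i n _ ?_ _ hi).trans hR
          rw [← wordMap_congr (hT1 v hv)]
          exact hp2 v n⟩
        exact ⟨y, fun _ => ⟨hy, hy'⟩⟩
      · exact ⟨x, fun h => absurd h hv⟩
    choose g hg using hpC
    -- Pigeonhole: words sent to the same centre y have level-q cylinders meeting the r-ball at y.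
    have hle : T.card ≤ ⌊A⌋₊ * C.card := by
      refine Finset.card_le_mul_card_image_of_maps_to (f := g) (fun v hv => (hg v hv).1) _ ?_
      intro y hy
      refine Nat.le_floor (hcard ω q y r hr _ ?_ ?_)
      · exact fun v hv v' hv' => hT3 v (Finset.mem_filter.mp hv).1 v' (Finset.mem_filter.mp hv').1
      · intro v hv
        obtain ⟨hv, hvy⟩ := Finset.mem_filter.mp hv
        exact ⟨p v, hp2 v q, hvy ▸ (hg v hv).2⟩
    rw [← ENNReal.ofReal_natCast]
    refine ENNReal.ofReal_le_ofReal ?_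
    have hT2' : (S.numProd ω q : ℝ) / S.numProd ω n = T.card := by
      rw [div_eq_iff (hN ω n).ne']
      exact_mod_cast hT2.symm
    rw [hT2', div_le_iff₀ (by linarith)]
    calc (T.card : ℝ) ≤ ⌊A⌋₊ * C.card := by exact_mod_cast hle
      _ ≤ A * C.card := by
          gcongr
          exact Nat.floor_le (by linarith)
      _ = C.card * A := mul_comm _ _
  · intro ω q r hr
    have hr0 : 0 ≤ r := le_trans (by have := S.ratioProd_pos ω q; positivity) hr
    obtain ⟨T, -, hT, -, hT'⟩ := exists_words (S := S) ω (fun j => ⟨0, S.N_pos _⟩) (Nat.zero_le q)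
    refine (coverNum_le_card hr0 (C := T.image fun v => S.wordMap ω v q δ₀) ?_).trans ?_
    · intro y hy
      obtain ⟨v, hv⟩ := exists_word_of_mem_attractor hy q
      obtain ⟨w, hw, hwv⟩ := hT' v (by simp)
      refine ⟨_, Finset.mem_image.mpr ⟨w, hw, rfl⟩, (hcyl ω w q y ?_ _ ⟨δ₀, hδ₀, rfl⟩).trans hr⟩
      rwa [wordMap_congr hwv]
    · rw [← ENNReal.ofReal_natCast]
      refine ENNReal.ofReal_le_ofReal ?_
      rw [numProd_zero, mul_one] at hT
      rw [← hT]
      exact_mod_cast Finset.card_image_le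

end HomogeneousFamily

/-! ### Large deviations and long runs for i.i.d. sequences. -/

section Probability

open ProbabilityTheory

variable {Λ : Type*} [MeasurableSpace Λ] (μ : Measure Λ) [IsProbabilityMeasure μ]

/-- Hoeffding: a nonnegative sum of m terms exceeds its mean by at least m|E|, linear in m. The rate
is uniform in the starting place n. -/
theorem exists_measure_window_sum_nonneg_le {X : Λ → ℝ} (hX : Measurable X) {B : ℝ}
    (hB : ∀ l, |X l| ≤ B) (hneg : ∫ l, X l ∂μ < 0) :
    ∃ γ : ℝ, 0 < γ ∧ ∀ n m : ℕ,
      (Measure.infinitePi fun _ : ℕ => μ) {ω | 0 ≤ ∑ j ∈ Finset.Ico n (n + m), X (ω j)} ≤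
        ENNReal.ofReal (Real.exp (-(γ * m))) := by
  set ν := Measure.infinitePi fun _ : ℕ => μ
  set E := ∫ l, X l ∂μ with hE
  have hint : ∀ j : ℕ, ∫ ω, X (ω j) ∂ν = E := fun j => by
    rw [hE, ← (measurePreserving_eval_infinitePi (fun _ : ℕ => μ) j).map_eq,
      integral_map (measurable_pi_apply j).aemeasurable hX.aestronglyMeasurable]
  -- The margin in |B| + 1 keeps the variance proxy positive for every B.
  set c : ℝ≥0 := (‖(|B| + 1) - (-(|B| + 1))‖₊ / 2) ^ 2 with hc
  have hc0 : 0 < c := by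
    have : (0 : ℝ) < (|B| + 1) - (-(|B| + 1)) := by linarith [abs_nonneg B]
    have := nnnorm_pos.mpr this.ne'
    exact pow_pos (div_pos this two_pos) 2
  have hsub : ∀ j : ℕ, HasSubgaussianMGF (fun ω : ℕ → Λ => X (ω j) - E) c ν := fun j => by
    have := hasSubgaussianMGF_of_mem_Icc (μ := ν) (X := fun ω => X (ω j)) (a := -(|B| + 1))
      (b := |B| + 1) (hX.comp (measurable_pi_apply j)).aemeasurable (ae_of_all _ fun ω => by
        have := abs_le.mp ((hB (ω j)).trans (le_abs_self B))
        constructor <;> linarith)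
    rwa [hint j] at this
  have hind : iIndepFun (fun (j : ℕ) (ω : ℕ → Λ) => X (ω j) - E) ν :=
    iIndepFun_infinitePi (P := fun _ : ℕ => μ) (X := fun _ l => X l - E) (by fun_prop)
  refine ⟨E ^ 2 / (2 * c), by have := sq_pos_of_neg hneg; positivity, fun n m => ?_⟩
  have h := HasSubgaussianMGF.measure_sum_ge_le_of_iIndepFun hind (c := fun _ => c)
    (s := Finset.Ico n (n + m)) (fun i _ => hsub i) (ε := -(m * E))
    (by have : (0 : ℝ) ≤ m := by positivity
        nlinarith)
  have hset : {ω : ℕ → Λ | 0 ≤ ∑ j ∈ Finset.Ico n (n + m), X (ω j)} =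
      {ω | -(m * E) ≤ ∑ j ∈ Finset.Ico n (n + m), (X (ω j) - E)} := by
    ext ω
    simp only [Set.mem_ofPred_eq, Finset.sum_sub_distrib, Finset.sum_const, Nat.card_Ico,
      add_tsub_cancel_left, nsmul_eq_mul]
    constructor <;> intro h <;> linarith
  rw [hset, ← ENNReal.ofReal_toReal (measure_ne_top ν _)]
  refine ENNReal.ofReal_le_ofReal (h.trans (Real.exp_le_exp.mpr (le_of_eq ?_)))
  have hc0' : (c : ℝ) ≠ 0 := by exact_mod_cast hc0.ne'
  simp only [Finset.sum_const, Nat.card_Ico, add_tsub_cancel_left, nsmul_eq_mul]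
  rcases Nat.eq_zero_or_pos m with rfl | hm
  · simp
  · have : (m : ℝ) ≠ 0 := by positivity
    push_cast
    field_simp

/-- Sums over windows `[n, n + m)` that are at least logarithmically long in `n` have the sign of
the expectation. -/
theorem exists_ae_eventually_window_sum_neg {X : Λ → ℝ} (hX : Measurable X) {B : ℝ}
    (hB : ∀ l, |X l| ≤ B) (hneg : ∫ l, X l ∂μ < 0) :
    ∃ K : ℝ, 0 < K ∧ ∀ᵐ ω ∂(Measure.infinitePi fun _ : ℕ => μ), ∀ᶠ n : ℕ in atTop, ∀ m : ℕ,
      K * Real.log (n + 1) ≤ m → ∑ j ∈ Finset.Ico n (n + m), X (ω j) < 0 := by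
  obtain ⟨γ, hγ, hle⟩ := exists_measure_window_sum_nonneg_le μ hX hB hneg
  -- With this K, half of the exponent γm pays for (n + 1)^{-2} and the other half is geometric in
  -- m. The bound is then summable over pairs (n, m), and Borel–Cantelli handles all m at once.
  refine ⟨4 / γ, by positivity, ?_⟩
  set bad : ℕ × ℕ → Set (ℕ → Λ) := fun p =>
    if 4 / γ * Real.log (p.1 + 1) ≤ p.2 then
      {ω | 0 ≤ ∑ j ∈ Finset.Ico p.1 (p.1 + p.2), X (ω j)} else ∅ with hbad
  have hbound : ∀ p : ℕ × ℕ, (Measure.infinitePi fun _ : ℕ => μ) (bad p) ≤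
      ENNReal.ofReal ((((p.1 + 1 : ℕ) : ℝ) ^ 2)⁻¹ * Real.exp (-(γ / 2)) ^ p.2) := by
    rintro ⟨n, m⟩
    simp only [hbad]
    split_ifs with h
    · refine (hle n m).trans (ENNReal.ofReal_le_ofReal ?_)
      have hn : (0 : ℝ) < n + 1 := by positivity
      have h2 : 2 * Real.log (n + 1) ≤ γ / 2 * m := by
        have := mul_le_mul_of_nonneg_left h (show 0 ≤ γ / 2 by positivity)
        calc 2 * Real.log (n + 1) = γ / 2 * (4 / γ * Real.log (n + 1)) := by field_simp; ring
          _ ≤ _ := this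
      have h3 : (((n + 1 : ℕ) : ℝ) ^ 2)⁻¹ = Real.exp (-(2 * Real.log (n + 1))) := by
        rw [Real.exp_neg, two_mul, Real.exp_add, Real.exp_log hn, ← sq]
        push_cast
        rfl
      rw [h3, ← Real.exp_nat_mul, ← Real.exp_add]
      exact Real.exp_le_exp.mpr (by linarith)
    · simp
  have hsum : ∑' p, (Measure.infinitePi fun _ : ℕ => μ) (bad p) ≠ ⊤ := by
    refine ne_top_of_le_ne_top ?_ (ENNReal.tsum_le_tsum hbound)
    refine Summable.tsum_ofReal_ne_top ?_
    refine Summable.mul_of_nonneg (f := fun n : ℕ => (((n + 1 : ℕ) : ℝ) ^ 2)⁻¹)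
      (g := fun m : ℕ => Real.exp (-(γ / 2)) ^ m) ?_ ?_ (fun _ => by positivity)
      (fun _ => by positivity)
    · exact (summable_nat_add_iff 1 (f := fun n : ℕ => ((n : ℝ) ^ 2)⁻¹)).mpr
        (Real.summable_nat_pow_inv.mpr one_lt_two)
    · exact summable_geometric_of_lt_one (Real.exp_pos _).le
        (Real.exp_lt_one_iff.mpr (by linarith))
  filter_upwards [ae_finite_setOfPred_mem hsum] with ω hω
  obtain ⟨n₀, hn₀⟩ := (hω.image Prod.fst).bddAbove
  filter_upwards [eventually_gt_atTop n₀] with n hn m hm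
  by_contra hcon
  have : n ∈ Prod.fst '' {p | ω ∈ bad p} := by
    refine ⟨(n, m), ?_, rfl⟩
    simp only [hbad, Set.mem_ofPred_eq, if_pos hm]
    exact not_lt.mp hcon
  exact absurd (hn₀ this) (by omega)

/-- The I blocks of length L are disjoint, hence independent, and each lies entirely in A with
probability μ(A)^L. -/
theorem measure_no_run {A : Set Λ} (hA : MeasurableSet A) (n L I : ℕ) :
    (Measure.infinitePi fun _ : ℕ => μ)
      {ω | ∀ i < I, ∃ j < L, ω (n + i * L + j) ∉ A} = (1 - μ A ^ L) ^ I := by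
  set ν := Measure.infinitePi fun _ : ℕ => μ
  have hcoord : ∀ k : ℕ, MeasurableSet {ω : ℕ → Λ | ω k ∈ A} := fun k => measurable_pi_apply k hA
  have hblock : ∀ k : ℕ, ν {ω | ∃ j < L, ω (k + j) ∉ A} = 1 - μ A ^ L := by
    intro k
    have h1 : {ω : ℕ → Λ | ∃ j < L, ω (k + j) ∉ A} =
        ((Finset.Ico k (k + L) : Set ℕ).pi fun _ => A)ᶜ := by
      ext ω
      simp only [Set.mem_ofPred_eq, Set.mem_compl_iff, Set.mem_pi, not_forall, Finset.coe_Ico,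
        Set.mem_Ico]
      constructor
      · rintro ⟨j, hj, h⟩
        exact ⟨k + j, ⟨by omega, by omega⟩, h⟩
      · rintro ⟨j, ⟨hj1, hj2⟩, h⟩
        exact ⟨j - k, by omega, by rwa [Nat.add_sub_cancel' hj1]⟩
    rw [h1, prob_compl_eq_one_sub
      (MeasurableSet.pi (Set.to_countable _) fun _ _ => hA), Measure.infinitePi_pi _ fun _ _ => hA]
    simp
  have hind : iIndep (fun k : ℕ => MeasurableSpace.comap (fun ω : ℕ → Λ => ω k) inferInstance) ν :=
    iIndepFun_infinitePi (P := fun _ : ℕ => μ) (X := fun _ l => l) (by fun_prop)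
  induction I with
  | zero => simp
  | succ I ih =>
    have hdisj : Disjoint (Set.Iio (n + I * L)) (Set.Ici (n + I * L)) := by
      rw [Set.disjoint_left]
      intro k hk hk'
      exact absurd (Set.mem_Ici.mp hk') (not_le.mpr (Set.mem_Iio.mp hk))
    have hI := indep_iSup_of_disjoint (fun k => (measurable_pi_apply k).comap_le) hind hdisj
    have hmeas : ∀ (S : Set ℕ) (k : ℕ), k ∈ S → MeasurableSet[⨆ k ∈ S,
        MeasurableSpace.comap (fun ω : ℕ → Λ => ω k) inferInstance] {ω : ℕ → Λ | ω k ∉ A} :=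
      fun S k hk => by
        have h1 : MeasurableSet[MeasurableSpace.comap (fun ω : ℕ → Λ => ω k) inferInstance]
          {ω : ℕ → Λ | ω k ∉ A} := ⟨Aᶜ, hA.compl, rfl⟩
        exact le_iSup₂ (f := fun k (_ : k ∈ S) =>
          MeasurableSpace.comap (fun ω : ℕ → Λ => ω k) inferInstance) k hk _ h1
    have hset : {ω : ℕ → Λ | ∀ i < I + 1, ∃ j < L, ω (n + i * L + j) ∉ A} =
        {ω | ∀ i < I, ∃ j < L, ω (n + i * L + j) ∉ A} ∩
          {ω | ∃ j < L, ω (n + I * L + j) ∉ A} := by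
      ext ω
      simp only [Set.mem_ofPred_eq, Set.mem_inter_iff, Nat.lt_succ_iff_lt_or_eq]
      constructor
      · exact fun h => ⟨fun i hi => h i (Or.inl hi), h I (Or.inr rfl)⟩
      · rintro ⟨h1, h2⟩ i (hi | rfl)
        exacts [h1 i hi, h2]
    rw [hset, (Indep_iff _ _ _).mp hI _ _ ?_ ?_, ih, hblock, pow_succ]
    · have : {ω : ℕ → Λ | ∀ i < I, ∃ j < L, ω (n + i * L + j) ∉ A} =
          ⋂ i, ⋂ (_ : i < I), ⋃ j, ⋃ (_ : j < L), {ω | ω (n + i * L + j) ∉ A} := by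
        ext ω
        simp
      rw [this]
      refine MeasurableSet.iInter fun i => MeasurableSet.iInter fun hi =>
        MeasurableSet.iUnion fun j => MeasurableSet.iUnion fun hj => hmeas _ _ ?_
      have : (i + 1) * L ≤ I * L := Nat.mul_le_mul_right L hi
      rw [Set.mem_Iio]
      nlinarith
    · have : {ω : ℕ → Λ | ∃ j < L, ω (n + I * L + j) ∉ A} =
          ⋃ j, ⋃ (_ : j < L), {ω | ω (n + I * L + j) ∉ A} := by
        ext ω
        simp
      rw [this]
      refine MeasurableSet.iUnion fun j => MeasurableSet.iUnion fun hj => hmeas _ _ ?_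
      exact Nat.le_add_right _ _

/-- Runs of length `L` in a set of positive measure occur at places that are at most exponentially
large in `L`. -/
theorem exists_ae_eventually_run {A : Set Λ} (hA : MeasurableSet A) (hpos : 0 < μ A) :
    ∃ M : ℕ, 2 ≤ M ∧ ∀ᵐ ω ∂(Measure.infinitePi fun _ : ℕ => μ), ∀ᶠ L : ℕ in atTop,
      ∃ n : ℕ, L ≤ n ∧ n ≤ M ^ L ∧ ∀ j < L, ω (n + j) ∈ A := by
  set p := (μ A).toReal with hp
  have hp0 : 0 < p := ENNReal.toReal_pos hpos.ne' (measure_ne_top _ _)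
  have hp1 : p ≤ 1 := ENNReal.toReal_le_of_le_ofReal zero_le_one (by simpa using prob_le_one)
  obtain ⟨M, hM⟩ := exists_nat_ge (2 / p)
  have hMp : 2 ≤ M * p := (div_le_iff₀ hp0).mp hM
  have hM2 : 2 ≤ M := by
    have : (2 : ℝ) ≤ M := hMp.trans (mul_le_of_le_one_right (by positivity) hp1)
    exact_mod_cast this
  -- Trying M^L blocks fails with probability at most exp(-(Mp)^L) ≤ e^{-L}, since Mp ≥ 2. The
  -- blocks start at L + iL with i < M^L, hence no later than M^{2L}; the offset L makes the places
  -- tend to infinity.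
  refine ⟨M ^ 2, by nlinarith, ?_⟩
  have hbound : ∀ L : ℕ, (Measure.infinitePi fun _ : ℕ => μ)
      {ω | ∀ i < M ^ L, ∃ j < L, ω (L + i * L + j) ∉ A} ≤ ENNReal.ofReal (Real.exp (-1) ^ L) := by
    intro L
    rw [measure_no_run μ hA, ← ENNReal.ofReal_toReal (measure_ne_top μ A), ← hp,
      ← ENNReal.ofReal_pow hp0.le, ← ENNReal.ofReal_one, ← ENNReal.ofReal_sub _ (by positivity),
      ← ENNReal.ofReal_pow (by linarith [pow_le_one₀ (n := L) hp0.le hp1])]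
    refine ENNReal.ofReal_le_ofReal ?_
    have h1 : 1 - p ^ L ≤ Real.exp (-(p ^ L)) := by linarith [Real.add_one_le_exp (-(p ^ L))]
    calc (1 - p ^ L) ^ M ^ L ≤ Real.exp (-(p ^ L)) ^ M ^ L :=
          pow_le_pow_left₀ (by linarith [pow_le_one₀ (n := L) hp0.le hp1]) h1 _
      _ = Real.exp (-((M * p) ^ L)) := by
          rw [← Real.exp_nat_mul, mul_pow]
          push_cast
          ring_nf
      _ ≤ Real.exp (-1) ^ L := by
          rw [← Real.exp_nat_mul]
          refine Real.exp_le_exp.mpr ?_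
          have h2 : (2 : ℝ) ^ L ≤ (M * p) ^ L := pow_le_pow_left₀ (by norm_num) hMp L
          have h3 : (L : ℝ) ≤ 2 ^ L := by exact_mod_cast Nat.lt_two_pow_self.le
          linarith
  have hsum : ∑' L : ℕ, (Measure.infinitePi fun _ : ℕ => μ)
      {ω | ∀ i < M ^ L, ∃ j < L, ω (L + i * L + j) ∉ A} ≠ ⊤ := by
    refine ne_top_of_le_ne_top ?_ (ENNReal.tsum_le_tsum hbound)
    exact (summable_geometric_of_lt_one (Real.exp_pos _).le
      (Real.exp_lt_one_iff.mpr (by norm_num))).tsum_ofReal_ne_top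
  filter_upwards [ae_eventually_notMem hsum] with ω hω
  filter_upwards [hω] with L hL
  simp only [not_forall, not_exists, not_and, not_not] at hL
  obtain ⟨i, hi, hrun⟩ := hL
  refine ⟨L + i * L, Nat.le_add_right _ _, ?_, hrun⟩
  calc L + i * L = (i + 1) * L := by ring
    _ ≤ M ^ L * M ^ L := Nat.mul_le_mul hi
        (Nat.lt_two_pow_self.le.trans (Nat.pow_le_pow_left hM2 L))
    _ = (M ^ 2) ^ L := by rw [← pow_mul, ← pow_add]; congr 1; ring

end Probability

/-! ### Dimensions from covering estimates. -/

theorem rpow_one_add_eq {R : ℝ} (hR0 : 0 < R) (hR1 : R < 1) (p : ℝ) :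
    R ^ (1 + p) = R * Real.exp (-(p * |Real.log R|)) := by
  rw [abs_of_neg (Real.log_neg hR0 hR1), Real.rpow_def_of_pos hR0]
  conv_rhs => rw [← Real.exp_log hR0, ← Real.exp_add, Real.log_exp]
  congr 1
  ring

theorem tendsto_abs_log_nhdsGT_zero : Tendsto (fun x : ℝ => |Real.log x|) (𝓝[>] 0) atTop :=
  tendsto_abs_atBot_atTop.comp Real.tendsto_log_nhdsGT_zero

section Dimension

variable {X : Type*} [PseudoMetricSpace X]

theorem phiAssouadDim_le_assouadDim (ψ : ℝ → ℝ) (A : Set X) :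
    phiAssouadDim ψ A ≤ assouadDim A := by
  refine sInf_le_sInf ?_
  rintro t ⟨s, rfl, C, hC, h⟩
  exact ⟨s, rfl, C, hC, fun r R hr _ hrR _ hR x hx => h r R hr hrR.le hR x hx⟩

theorem lowerBoxDim_le_upperBoxDim (A : Set X) : lowerBoxDim A ≤ upperBoxDim A :=
  liminf_le_limsup

theorem le_lowerBoxDim {A : Set X} {s C : ℝ} (hC : 0 < C)
    (h : ∀ᶠ r : ℝ in 𝓝[>] 0, ENNReal.ofReal (C * r ^ (-s)) ≤ coverNum r A) :
    (s : EReal) ≤ lowerBoxDim A := by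
  refine EReal.ge_of_forall_gt_iff_ge.mp fun t ht => ?_
  have ht : t < s := by exact_mod_cast ht
  refine le_liminf_of_le (by isBoundedDefault) ?_
  filter_upwards [h, self_mem_nhdsWithin, nhdsWithin_le_nhds (gt_mem_nhds one_pos),
    tendsto_abs_log_nhdsGT_zero.eventually_ge_atTop (-Real.log C / (s - t))] with r hr hr0 hr1 hlog
  have hr0 : 0 < r := hr0
  have hneg := Real.log_neg hr0 hr1
  rw [abs_of_neg hneg, div_le_iff₀ (by linarith)] at hlog
  rw [EReal.le_div_iff_mul_le (by exact_mod_cast neg_pos.mpr hneg) (EReal.coe_ne_top _)]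
  refine le_trans ?_ (ENNReal.log_le_log hr)
  rw [ENNReal.log_ofReal_of_pos (by positivity), Real.log_mul hC.ne' (by positivity),
    Real.log_rpow hr0]
  have : t * -Real.log r ≤ Real.log C + -s * Real.log r := by nlinarith
  exact_mod_cast this

theorem upperBoxDim_le {A : Set X} {s C : ℝ} (hC : 0 < C)
    (h : ∀ᶠ r : ℝ in 𝓝[>] 0, coverNum r A ≤ ENNReal.ofReal (C * r ^ (-s))) :
    upperBoxDim A ≤ s := by
  refine EReal.le_of_forall_lt_iff_le.mp fun t ht => ?_
  have ht : s < t := by exact_mod_cast ht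
  refine limsup_le_of_le (by isBoundedDefault) ?_
  filter_upwards [h, self_mem_nhdsWithin, nhdsWithin_le_nhds (gt_mem_nhds one_pos),
    tendsto_abs_log_nhdsGT_zero.eventually_ge_atTop (Real.log C / (t - s))] with r hr hr0 hr1 hlog
  have hr0 : 0 < r := hr0
  have hneg := Real.log_neg hr0 hr1
  rw [abs_of_neg hneg, div_le_iff₀ (by linarith)] at hlog
  rw [EReal.div_le_iff_le_mul (by exact_mod_cast neg_pos.mpr hneg) (EReal.coe_ne_top _)]
  refine (ENNReal.log_le_log hr).trans ?_
  rw [ENNReal.log_ofReal_of_pos (by positivity), Real.log_mul hC.ne' (by positivity),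
    Real.log_rpow hr0]
  have : Real.log C + -s * Real.log r ≤ -Real.log r * t := by nlinarith
  exact_mod_cast this

end Dimension

/-! ### From windows of levels to dimension bounds. -/

namespace HomogeneousFamily

variable {Λ : Type*} [MeasurableSpace Λ] {d : ℕ} (S : HomogeneousFamily Λ d)

/-- Comparison of covering numbers of the attractor with numbers of cylinders, with a
multiplicative constant `A` and a constant `D` for the size of the cylinders of level `0`. -/
structure CoverBounds (ω : ℕ → Λ) (A D : ℝ) : Prop where
  one_le_A : 1 ≤ A
  one_le_D : 1 ≤ D
  ball_le : ∀ n q : ℕ, n ≤ q → ∀ (x : EuclideanSpace ℝ (Fin d)) (R r : ℝ),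
    R ≤ S.ratioProd ω n → D * S.ratioProd ω q ≤ r →
      coverNum r (S.attractor ω ∩ Metric.closedBall x R) ≤
        ENNReal.ofReal (A * (S.numProd ω q / S.numProd ω n))
  le_ball : ∀ n q : ℕ, n ≤ q → ∀ x ∈ S.attractor ω, ∀ R r : ℝ,
    D * S.ratioProd ω n ≤ R → 0 ≤ r → r ≤ S.ratioProd ω q →
      ENNReal.ofReal (S.numProd ω q / S.numProd ω n / A) ≤
        coverNum r (S.attractor ω ∩ Metric.closedBall x R)
  le_whole : ∀ (q : ℕ) (r : ℝ), D * S.ratioProd ω q ≤ r →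
    coverNum r (S.attractor ω) ≤ ENNReal.ofReal (S.numProd ω q)

theorem UniformOSC.exists_coverBounds {S : HomogeneousFamily Λ d} (hS : S.UniformOSC) :
    ∃ A D : ℝ, ∀ ω, S.CoverBounds ω A D := by
  obtain ⟨A, D, hA, hD, h1, h2, h3⟩ := S.exists_coverNum_bounds hS
  exact ⟨A, D, fun ω => ⟨hA, hD, h1 ω, h2 ω, h3 ω⟩⟩

theorem exists_c_bounds : ∃ a b : ℝ, 0 < a ∧ a ≤ b ∧ b < 1 ∧ ∀ l, a ≤ S.c l ∧ S.c l ≤ b := by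
  obtain ⟨a, b, ha, hb, h⟩ := S.c_bdd
  rcases isEmpty_or_nonempty Λ with hΛ | ⟨⟨l⟩⟩
  · exact ⟨1 / 2, 1 / 2, by norm_num, le_rfl, by norm_num, fun l => hΛ.elim l⟩
  · exact ⟨a, b, ha, (h l).1.trans (h l).2, hb, h⟩

section Levels

variable {S} {ω : ℕ → Λ} {a b : ℝ}

theorem numProd_cast_pos (ω : ℕ → Λ) (n : ℕ) : (0 : ℝ) < S.numProd ω n := by
  exact_mod_cast S.numProd_pos ω n

theorem numProd_mono (ω : ℕ → Λ) : Monotone (S.numProd ω) :=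
  monotone_nat_of_le_succ fun n => by
    rw [numProd_succ]
    exact Nat.le_mul_of_pos_right _ (S.N_pos _)

theorem ratioProd_strictAnti (hb : b < 1) (h : ∀ l, S.c l ≤ b) (ω : ℕ → Λ) :
    StrictAnti (S.ratioProd ω) :=
  strictAnti_nat_of_succ_lt fun n => by
    rw [ratioProd_succ]
    exact mul_lt_of_lt_one_right (S.ratioProd_pos ω n) ((h _).trans_lt hb)

theorem ratioProd_le_pow_mul (hb : 0 ≤ b) (h : ∀ l, S.c l ≤ b) {n q : ℕ} (hnq : n ≤ q) :
    S.ratioProd ω q ≤ b ^ (q - n) * S.ratioProd ω n := by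
  induction q, hnq using Nat.le_induction with
  | base => simp
  | succ q hnq ih =>
    rw [ratioProd_succ, Nat.succ_sub hnq, pow_succ, mul_right_comm]
    exact mul_le_mul ih (h _) (S.c_pos _).le (by have := S.ratioProd_pos ω n; positivity)

theorem pow_mul_ratioProd_le (ha : 0 ≤ a) (h : ∀ l, a ≤ S.c l) {n q : ℕ} (hnq : n ≤ q) :
    a ^ (q - n) * S.ratioProd ω n ≤ S.ratioProd ω q := by
  induction q, hnq using Nat.le_induction with
  | base => simp
  | succ q hnq ih =>
    rw [ratioProd_succ, Nat.succ_sub hnq, pow_succ, mul_right_comm]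
    exact mul_le_mul ih (h _) ha (S.ratioProd_pos ω q).le

variable (S) in
theorem tendsto_ratioProd (ω : ℕ → Λ) : Tendsto (S.ratioProd ω) atTop (𝓝 0) := by
  obtain ⟨a, b, ha, hab, hb, h⟩ := S.exists_c_bounds
  refine squeeze_zero (fun n => (S.ratioProd_pos ω n).le) (fun n => ?_)
    (tendsto_pow_atTop_nhds_zero_of_lt_one (ha.le.trans hab) hb)
  have := ratioProd_le_pow_mul (ω := ω) (ha.le.trans hab) (fun l => (h l).2) (Nat.zero_le n)
  simpa [ratioProd_zero] using this

theorem exists_level {r : ℝ} (hr : 0 < r) {n : ℕ} (hrn : r ≤ S.ratioProd ω n) :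
    ∃ q, n ≤ q ∧ S.ratioProd ω (q + 1) < r ∧ r ≤ S.ratioProd ω q := by
  classical
  have hex : ∃ m, S.ratioProd ω (n + m) < r := by
    have := ((S.tendsto_ratioProd ω).comp (tendsto_add_atTop_nat n)).eventually (gt_mem_nhds hr)
    obtain ⟨m, hm⟩ := this.exists
    exact ⟨m, by simpa [add_comm] using hm⟩
  have hspec := Nat.find_spec hex
  have hne : Nat.find hex ≠ 0 := fun h0 => by
    rw [h0] at hspec
    exact absurd hspec (not_lt.mpr hrn)
  obtain ⟨m, hm⟩ := Nat.exists_eq_succ_of_ne_zero hne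
  refine ⟨n + m, Nat.le_add_right _ _, ?_, not_lt.mp (Nat.find_min hex (by omega))⟩
  rw [hm] at hspec
  exact hspec

/-- Ratios of consecutive levels are at least a, so rounding R and r to levels costs a factor 1/a
each, and shrinking cylinders below r costs D. -/
theorem exists_levels (ha : 0 < a) (h : ∀ l, a ≤ S.c l) {D r R : ℝ} (hD : 1 ≤ D) (hr : 0 < r)
    (hrR : r ≤ R) (hR : R ≤ 1) : ∃ n q, n ≤ q ∧ S.ratioProd ω (n + 1) < R ∧
      R ≤ S.ratioProd ω n ∧ D * S.ratioProd ω q ≤ r ∧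
      S.ratioProd ω n / S.ratioProd ω q ≤ D / a ^ 2 * (R / r) := by
  obtain ⟨n, -, hn1, hn2⟩ := exists_level (S := S) (ω := ω) (hr.trans_le hrR) (n := 0)
    (by rwa [ratioProd_zero])
  have hD0 : 0 < D := by linarith
  obtain ⟨q, hq, hq1, hq2⟩ := exists_level (S := S) (ω := ω) (r := r / D) (by positivity) (n := n)
    ((div_le_self hr.le hD).trans (hrR.trans hn2))
  refine ⟨n, q + 1, by omega, hn1, hn2, ?_, ?_⟩
  · rw [lt_div_iff₀ hD0] at hq1
    linarith
  · have h1 : a * S.ratioProd ω n ≤ R := by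
      rw [ratioProd_succ] at hn1
      nlinarith [h (ω n), S.ratioProd_pos ω n]
    have h2 : a * (r / D) ≤ S.ratioProd ω (q + 1) := by
      rw [ratioProd_succ]
      have : 0 < r / D := by positivity
      nlinarith [h (ω q), S.ratioProd_pos ω q]
    rw [div_le_iff₀ (S.ratioProd_pos ω _)]
    calc S.ratioProd ω n ≤ R / a := by rwa [le_div_iff₀ ha, mul_comm]
      _ = D / a ^ 2 * (R / r) * (a * (r / D)) := by field_simp
      _ ≤ _ := mul_le_mul_of_nonneg_left h2 (by have := hr.trans_le hrR; positivity)

end Levels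

variable {S} {ω : ℕ → Λ} {A D : ℝ}

/-- An admissible t < s would give e^{ys} ≤ const · e^{yt} along the radii R = D · `ratioProd ω n`,
where R/r = e^y. This fails once y is large, so infinitely many good n suffice. -/
theorem CoverBounds.le_phiAssouadDim (hcov : S.CoverBounds ω A D) {s : ℝ} (hs : 0 ≤ s) {ψ : ℝ → ℝ}
    (hψ : Tendsto (fun x => ψ x * |Real.log x|) (𝓝[>] 0) atTop)
    (hfreq : ∃ᶠ n in atTop, ∀ q, n ≤ q →
      S.ratioProd ω (q + 1) < (D * S.ratioProd ω n) ^ (1 + ψ (D * S.ratioProd ω n)) →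
      (D * S.ratioProd ω n) ^ (1 + ψ (D * S.ratioProd ω n)) ≤ S.ratioProd ω q →
      (S.ratioProd ω n / S.ratioProd ω q) ^ s ≤ (S.numProd ω q : ℝ) / S.numProd ω n) :
    (s : EReal) ≤ phiAssouadDim ψ (S.attractor ω) := by
  obtain ⟨a, b, ha, -, -, hc⟩ := S.exists_c_bounds
  have hA := hcov.one_le_A
  have hD := hcov.one_le_D
  refine le_sInf ?_
  rintro _ ⟨t, rfl, C, hC, hCt⟩
  by_contra hlt
  have hlt : t < s := by
    rw [not_le] at hlt
    exact_mod_cast hlt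
  have hR0 : ∀ n, 0 < D * S.ratioProd ω n := fun n => by
    have := S.ratioProd_pos ω n
    positivity
  have htend : Tendsto (fun n => D * S.ratioProd ω n) atTop (𝓝[>] 0) := by
    refine tendsto_nhdsWithin_iff.mpr ⟨?_, Eventually.of_forall hR0⟩
    simpa using (S.tendsto_ratioProd ω).const_mul D
  obtain ⟨x, hx⟩ := S.attractor_nonempty ω
  -- At y = Y the two sides of the final comparison are equal. Requiring also y > log D puts r below
  -- the ratio of level n, so a level q ≥ n exists.
  set Y := Real.log (A * C * (D / a) ^ s) / (s - t) with hY
  have hev := (hψ.comp htend).eventually_gt_atTop (max (max Y (Real.log D)) 0)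
  have hev1 := htend.eventually (nhdsWithin_le_nhds (gt_mem_nhds (one_pos : (0 : ℝ) < 1)))
  obtain ⟨n, hn, hny, hR1⟩ := (hfreq.and_eventually (hev.and hev1)).exists
  set R := D * S.ratioProd ω n with hR
  set y := ψ R * |Real.log R| with hy
  have hyY : max (max Y (Real.log D)) 0 < y := hny
  obtain ⟨⟨hyY, hyD⟩, hy0⟩ : (Y < y ∧ Real.log D < y) ∧ 0 < y := by simpa using hyY
  have hr : R ^ (1 + ψ R) = R * Real.exp (-y) := rpow_one_add_eq (hR0 n) hR1 (ψ R)
  set r := R ^ (1 + ψ R) with hrdef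
  have hRpos : 0 < R := hR0 n
  have hrpos : 0 < r := Real.rpow_pos_of_pos hRpos _
  have hRr : R / r = Real.exp y := by
    rw [hr, Real.exp_neg]
    field_simp
  have hcn := S.ratioProd_pos ω n
  have hrn : r ≤ S.ratioProd ω n := by
    have h1 : D ≤ Real.exp y := by
      rw [← Real.exp_log (show 0 < D by linarith)]
      exact Real.exp_le_exp.mpr hyD.le
    rw [hr, hR, Real.exp_neg, ← div_eq_mul_inv, div_le_iff₀ (Real.exp_pos y)]
    nlinarith
  have hrR : r < R := by
    rw [hr]
    exact mul_lt_of_lt_one_right hRpos (Real.exp_lt_one_iff.mpr (by linarith))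
  obtain ⟨q, hnq, hq1, hq2⟩ := exists_level hrpos hrn
  have hwin := hn q hnq hq1 hq2
  have h1 := (hcov.le_ball n q hnq x hx R r le_rfl hrpos.le hq2).trans
    (hCt r R hrpos hrdef hrR hRpos hR1 x hx)
  rw [ENNReal.ofReal_le_ofReal_iff (by positivity), div_le_iff₀ (by linarith), hRr] at h1
  have hcq := S.ratioProd_pos ω q
  have h2 : Real.exp y * (a / D) ≤ S.ratioProd ω n / S.ratioProd ω q := by
    rw [le_div_iff₀ hcq, ← hRr, hR]
    rw [ratioProd_succ] at hq1
    have h3 : S.ratioProd ω q * a ≤ r := (mul_le_mul_of_nonneg_left (hc _).1 hcq.le).trans hq1.le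
    calc D * S.ratioProd ω n / r * (a / D) * S.ratioProd ω q
        = S.ratioProd ω n * ((S.ratioProd ω q * a) / r) := by field_simp
      _ ≤ S.ratioProd ω n * 1 := by
          gcongr
          exact (div_le_one hrpos).mpr h3
      _ = _ := mul_one _
  have h3 : (Real.exp y * (a / D)) ^ s ≤ C * Real.exp y ^ t * A :=
    (Real.rpow_le_rpow (by positivity) h2 hs).trans (hwin.trans h1)
  have hlog := Real.log_le_log (by positivity) h3
  have hD0 : D ≠ 0 := by linarith
  rw [Real.log_rpow (by positivity), Real.log_mul (by positivity) (by positivity), Real.log_exp,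
    Real.log_mul (by positivity) (by positivity), Real.log_mul (by positivity) (by positivity),
    Real.log_rpow (by positivity), Real.log_exp, Real.log_div ha.ne' hD0] at hlog
  rw [hY, div_lt_iff₀ (by linarith), Real.log_mul (by positivity) (by positivity),
    Real.log_mul (by positivity) (by positivity), Real.log_rpow (by positivity),
    Real.log_div hD0 ha.ne'] at hyY
  nlinarith

/-- The constant precedes the radii and the window hypothesis concerns only the given pair, so this
serves both the Assouad dimension and its restricted version. -/
theorem CoverBounds.exists_ball_le (hcov : S.CoverBounds ω A D) {s : ℝ} (hs : 0 ≤ s) :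
    ∃ C : ℝ, 0 < C ∧ ∀ r R : ℝ, 0 < r → r ≤ R → R ≤ 1 →
      (∀ n q, n ≤ q → S.ratioProd ω (n + 1) < R → R ≤ S.ratioProd ω n →
        D * S.ratioProd ω q ≤ r →
        (S.numProd ω q : ℝ) / S.numProd ω n ≤ (S.ratioProd ω n / S.ratioProd ω q) ^ s) →
      ∀ x, coverNum r (S.attractor ω ∩ Metric.closedBall x R) ≤
        ENNReal.ofReal (C * (R / r) ^ s) := by
  obtain ⟨a, b, ha, -, -, hc⟩ := S.exists_c_bounds
  have hA := hcov.one_le_A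
  have hD := hcov.one_le_D
  refine ⟨A * (D / a ^ 2) ^ s, by positivity, fun r R hr hrR hR hwin x => ?_⟩
  obtain ⟨n, q, hnq, hn1, hn2, hq, hle⟩ :=
    exists_levels (ω := ω) ha (fun l => (hc l).1) hD hr hrR hR
  refine (hcov.ball_le n q hnq x R r hn2 hq).trans (ENNReal.ofReal_le_ofReal ?_)
  have hR0 := hr.trans_le hrR
  have := S.ratioProd_pos ω n
  have := S.ratioProd_pos ω q
  rw [mul_assoc, ← Real.mul_rpow (by positivity) (by positivity)]
  have := Real.rpow_le_rpow (by positivity) hle hs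
  gcongr
  exact (hwin n q hnq hn1 hn2 hq).trans this

theorem CoverBounds.assouadDim_le (hcov : S.CoverBounds ω A D) {s : ℝ} (hs : 0 ≤ s)
    (hwin : ∀ n q, n ≤ q →
      (S.numProd ω q : ℝ) / S.numProd ω n ≤ (S.ratioProd ω n / S.ratioProd ω q) ^ s) :
    assouadDim (S.attractor ω) ≤ s := by
  obtain ⟨C, hC, h⟩ := hcov.exists_ball_le hs
  exact sInf_le ⟨s, rfl, C, hC, fun r R hr hrR hR x _ =>
    h r R hr hrR hR.le (fun n q hnq _ _ _ => hwin n q hnq) x⟩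

/-- Windows are controlled only for R < R₀. For larger R the global bound is enough, since r^{-s} ≤
R₀^{-s} (R/r)^s. -/
theorem CoverBounds.phiAssouadDim_le (hcov : S.CoverBounds ω A D) {s : ℝ} (hs : 0 ≤ s)
    {ψ : ℝ → ℝ} {C : ℝ} (hC : 0 < C)
    (hbox : ∀ r : ℝ, 0 < r → r < 1 →
      coverNum r (S.attractor ω) ≤ ENNReal.ofReal (C * r ^ (-s)))
    (hev : ∀ᶠ R in 𝓝[>] 0, ∀ n q, n ≤ q → S.ratioProd ω (n + 1) < R → R ≤ S.ratioProd ω n →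
      D * S.ratioProd ω q ≤ R ^ (1 + ψ R) →
      (S.numProd ω q : ℝ) / S.numProd ω n ≤ (S.ratioProd ω n / S.ratioProd ω q) ^ s) :
    phiAssouadDim ψ (S.attractor ω) ≤ s := by
  obtain ⟨C', hC', h⟩ := hcov.exists_ball_le hs
  obtain ⟨R₀, hR₀, hR₀'⟩ := mem_nhdsGT_iff_exists_Ioo_subset.mp hev
  have hR₀ : 0 < R₀ := hR₀
  refine sInf_le ⟨s, rfl, max C' (C * (R₀⁻¹) ^ s), lt_max_of_lt_left hC',
    fun r R hr hrR hlt hR0 hR1 x _ => ?_⟩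
  by_cases hR : R < R₀
  · refine (h r R hr hlt.le hR1.le (fun n q hnq hn1 hn2 hq => ?_) x).trans
      (ENNReal.ofReal_le_ofReal ?_)
    · exact hR₀' ⟨hR0, hR⟩ n q hnq hn1 hn2 (hrR ▸ hq)
    · gcongr
      exact le_max_left _ _
  · refine (coverNum_mono Set.inter_subset_left).trans ((hbox r hr (hlt.trans hR1)).trans
      (ENNReal.ofReal_le_ofReal ?_))
    calc C * r ^ (-s) ≤ C * (R₀⁻¹) ^ s * (R / r) ^ s := by
          rw [mul_assoc, ← Real.mul_rpow (by positivity) (by positivity), Real.rpow_neg hr.le,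
            ← Real.inv_rpow hr.le]
          gcongr
          rw [div_eq_mul_inv, ← mul_assoc]
          refine le_mul_of_one_le_left (by positivity) ?_
          rw [inv_mul_eq_div, one_le_div hR₀]
          exact not_lt.mp hR
      _ ≤ _ := by
          gcongr
          exact le_max_right _ _

end HomogeneousFamily

/-! ### Dimension functions -/

/-- If φ(x)|log x| is non-decreasing in x, the terms of the series stay away from 0. Otherwise they
eventually decrease, and a summable decreasing sequence is O(1/k). -/
theorem eventually_log_abs_log_le {φ : ℝ → ℝ} (hφ : IsDimensionFunction φ)
    (hsum : SumConverges φ) :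
    ∀ᶠ x in 𝓝[>] 0, Real.log |Real.log x| ≤ 2 * (φ x * |Real.log x|) := by
  obtain ⟨δ, hδ, hδ1, -, -, hmono⟩ := hφ
  set g : ℝ → ℝ := fun x => φ x * |Real.log x| with hg
  have hterm : ∀ k : ℕ, Real.exp (-(φ (Real.exp (-((k + 1 : ℕ) : ℝ))) * ((k + 1 : ℕ) : ℝ))) =
      Real.exp (-g (Real.exp (-((k + 1 : ℕ) : ℝ)))) := fun k => by
    simp only [hg, Real.log_exp, abs_neg, Nat.abs_cast]
  unfold SumConverges at hsum
  simp_rw [hterm] at hsum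
  have htend : Tendsto (fun k : ℕ => Real.exp (-((k + 1 : ℕ) : ℝ))) atTop (𝓝 0) :=
    Real.tendsto_exp_neg_atTop_nhds_zero.comp
      (tendsto_natCast_atTop_atTop.comp (tendsto_add_atTop_nat 1))
  rcases hmono with hmono | hanti
  · exfalso
    have h0 := hsum.tendsto_atTop_zero.eventually (gt_mem_nhds (Real.exp_pos (-g (δ / 2))))
    have h1 := htend.eventually (gt_mem_nhds (show 0 < δ / 2 by positivity))
    obtain ⟨k, hk0, hk1⟩ := (h0.and h1).exists
    have := hmono ⟨Real.exp_pos _, by linarith⟩ ⟨by positivity, by linarith⟩ hk1.le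
    rw [Real.exp_lt_exp] at hk0
    linarith
  · obtain ⟨k₀, hk₀⟩ := eventually_atTop.mp (htend.eventually (gt_mem_nhds hδ))
    set a : ℕ → ℝ := fun k => Real.exp (-g (Real.exp (-((k + 1 : ℕ) : ℝ)))) with ha
    set T := ∑' k, a k with hT
    have hanti' : ∀ j k, k₀ ≤ j → j ≤ k → a k ≤ a j := fun j k hj hjk => by
      refine Real.exp_le_exp.mpr (neg_le_neg (hanti ⟨Real.exp_pos _, hk₀ k (by omega)⟩
        ⟨Real.exp_pos _, hk₀ j hj⟩ (Real.exp_le_exp.mpr (neg_le_neg ?_))))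
      exact_mod_cast Nat.succ_le_succ hjk
    have hle : ∀ k, k₀ ≤ k → ((k : ℝ) + 1 - k₀) * a k ≤ T := fun k hk => by
      calc ((k : ℝ) + 1 - k₀) * a k = ∑ j ∈ Finset.Ico k₀ (k + 1), a k := by
            rw [Finset.sum_const, Nat.card_Ico, nsmul_eq_mul, Nat.cast_sub (by omega)]
            push_cast
            ring
        _ ≤ ∑ j ∈ Finset.Ico k₀ (k + 1), a j := Finset.sum_le_sum fun j hj => by
            rw [Finset.mem_Ico] at hj
            exact hanti' j k hj.1 (by omega)
        _ ≤ T := hsum.sum_le_tsum _ fun _ _ => (Real.exp_pos _).le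
    have hT0 : 0 ≤ T := tsum_nonneg fun _ => (Real.exp_pos _).le
    -- With u = |log x|, the first threshold gives k + 1 - k₀ ≥ u/2. The second turns (u a_k / 2)² ≤
    -- T² into u a_k² ≤ 1, which is the factor 2 of the conclusion.
    filter_upwards [tendsto_abs_log_nhdsGT_zero.eventually_ge_atTop
        (max (2 * k₀ + 2) (4 * T ^ 2 + 2)), self_mem_nhdsWithin,
      nhdsWithin_le_nhds (gt_mem_nhds (one_pos : (0 : ℝ) < 1))] with x hx hx0 hx1
    have hx0 : 0 < x := hx0
    obtain ⟨hx2, hx3⟩ := max_le_iff.mp hx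
    set u := |Real.log x| with hu
    have hu1 : (1 : ℕ) ≤ ⌊u⌋₊ := Nat.le_floor (by
      have : (0 : ℝ) ≤ k₀ := by positivity
      push_cast
      linarith)
    obtain ⟨k, hk⟩ : ∃ k, ⌊u⌋₊ = k + 1 := ⟨⌊u⌋₊ - 1, by omega⟩
    have hk1 : ((k + 1 : ℕ) : ℝ) ≤ u := hk ▸ Nat.floor_le (abs_nonneg _)
    have hk2 : u < (k : ℝ) + 2 := by
      have := Nat.lt_floor_add_one u
      rw [hk] at this
      push_cast at this
      linarith
    have hkk : (2 * k₀ : ℝ) ≤ k := by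
      have : ((2 * k₀ : ℕ) : ℝ) < ((k + 1 : ℕ) : ℝ) := by push_cast; linarith
      have : 2 * k₀ < k + 1 := by exact_mod_cast this
      exact_mod_cast Nat.lt_succ_iff.mp this
    have hkk' : k₀ ≤ k := by
      have : (k₀ : ℝ) ≤ k := by
        have : (0 : ℝ) ≤ k₀ := by positivity
        linarith
      exact_mod_cast this
    have hxe : x ≤ Real.exp (-((k + 1 : ℕ) : ℝ)) := by
      rw [← Real.log_le_iff_le_exp hx0]
      have := abs_of_neg (Real.log_neg hx0 hx1)
      linarith
    have hgx : g (Real.exp (-((k + 1 : ℕ) : ℝ))) ≤ g x :=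
      hanti ⟨hx0, hxe.trans_lt (hk₀ k hkk')⟩ ⟨Real.exp_pos _, hk₀ k hkk'⟩ hxe
    have hak : 0 < a k := Real.exp_pos _
    have h1 : (u / 2) * a k ≤ T := (mul_le_mul_of_nonneg_right (by linarith) hak.le).trans
      (hle k hkk')
    have hupos : 0 < u := by nlinarith [sq_nonneg T]
    have h2 : u * a k ^ 2 ≤ 1 := by
      have h3 : ((u / 2) * a k) ^ 2 ≤ T ^ 2 := pow_le_pow_left₀ (by positivity) h1 2
      have h4 : u * (u * a k ^ 2) ≤ u * 1 := by nlinarith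
      exact le_of_mul_le_mul_left h4 hupos
    have h3 := Real.log_le_log (by positivity) h2
    rw [Real.log_mul hupos.ne' (by positivity), Real.log_pow, Real.log_one, ha, Real.log_exp] at h3
    push_cast at h3 hgx
    linarith

/-- If φ(e^{-k})k > 2 log k held eventually, comparison with ∑ k^{-2} would give convergence. A
bound at e^{-k} passes to all x ≥ e^{-k} near 0 because φ(x)|log x| is non-increasing there; the
other monotonicity would bound ψ(x)|log x|. -/
theorem IsDimensionFunction.frequently_le_log {φ ψ : ℝ → ℝ} (hφ : IsDimensionFunction φ)
    (hsum : ¬ SumConverges φ) {C : ℝ} (hC : 0 < C)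
    (hψ : Tendsto (fun x => ψ x * |Real.log x|) (𝓝[>] 0) atTop)
    (hψφ : ∀ᶠ x in 𝓝[>] 0, ψ x ≤ C * φ x) :
    ∃ δ : ℝ, 0 < δ ∧ δ ≤ 1 ∧ ∃ᶠ k : ℕ in atTop, ∀ x, Real.exp (-k) ≤ x → x < δ →
      ψ x * |Real.log x| ≤ 2 * C * Real.log k := by
  obtain ⟨δ, hδ, hδ1, -, -, hmono⟩ := hφ
  set g : ℝ → ℝ := fun x => φ x * |Real.log x| with hg
  obtain ⟨ε, hε, hεC⟩ := mem_nhdsGT_iff_exists_Ioo_subset.mp hψφ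
  have hε : 0 < ε := hε
  have hle : ∀ x, 0 < x → x < ε → ψ x * |Real.log x| ≤ C * g x := fun x hx0 hx => by
    rw [hg, ← mul_assoc]
    exact mul_le_mul_of_nonneg_right (hεC ⟨hx0, hx⟩) (abs_nonneg _)
  refine ⟨min δ ε, lt_min hδ hε, (min_le_left _ _).trans hδ1, ?_⟩
  rcases hmono with hmono | hanti
  · exfalso
    have hsmall : ∀ᶠ x : ℝ in 𝓝[>] 0, 0 < x ∧ x < min (δ / 2) ε :=
      Ioo_mem_nhdsGT (show 0 < min (δ / 2) ε by positivity)
    obtain ⟨x, hx, hx0, hx1⟩ := ((hψ.eventually_gt_atTop (C * g (δ / 2))).and hsmall).exists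
    obtain ⟨hx2, hx3⟩ := lt_min_iff.mp hx1
    have h1 := hmono ⟨hx0, by linarith⟩ ⟨by positivity, by linarith⟩ hx2.le
    have h2 := hle x hx0 hx3
    have h3 := mul_le_mul_of_nonneg_left h1 hC.le
    simp only [hg] at h2 h3 hx
    linarith
  · have hfreq : ∃ᶠ k : ℕ in atTop, g (Real.exp (-k)) ≤ 2 * Real.log k := by
      by_contra hcon
      rw [not_frequently] at hcon
      apply hsum
      unfold SumConverges
      refine (summable_nat_add_iff 1
        (f := fun k : ℕ => Real.exp (-(φ (Real.exp (-(k : ℝ))) * (k : ℝ))))).mpr ?_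
      refine Summable.of_norm_bounded_eventually_nat
        (Real.summable_nat_pow_inv.mpr one_lt_two) ?_
      filter_upwards [hcon, eventually_gt_atTop 0] with k hk hk0
      have hk0' : (0 : ℝ) < k := by exact_mod_cast hk0
      rw [Real.norm_of_nonneg (Real.exp_pos _).le]
      have h1 : (((k : ℝ)) ^ 2)⁻¹ = Real.exp (-(2 * Real.log k)) := by
        rw [Real.exp_neg, two_mul, Real.exp_add, Real.exp_log hk0', ← sq]
      rw [h1]
      refine Real.exp_le_exp.mpr (neg_le_neg ?_)
      simp only [hg, Real.log_exp, abs_neg, Nat.abs_cast, not_le] at hk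
      exact hk.le
    refine hfreq.mono fun k hk x hx hxδ => ?_
    obtain ⟨hx1, hx2⟩ := lt_min_iff.mp hxδ
    have hx0 := (Real.exp_pos _).trans_le hx
    have h1 := hanti ⟨Real.exp_pos _, hx.trans_lt hx1⟩ ⟨hx0, hx1⟩ hx
    calc ψ x * |Real.log x| ≤ C * g x := hle x hx0 hx2
      _ ≤ C * (2 * Real.log k) := mul_le_mul_of_nonneg_left (h1.trans hk) hC.le
      _ = _ := by ring

namespace HomogeneousFamily

variable {Λ : Type*} [MeasurableSpace Λ] {d : ℕ} (S : HomogeneousFamily Λ d)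

/-! ### Windows of levels -/

/-- `log 𝔖_l^s`. -/
def logRatioSum (s : ℝ) (l : Λ) : ℝ := Real.log (S.N l) + s * Real.log (S.c l)

theorem ratioSum_eq_exp (s : ℝ) (l : Λ) : S.ratioSum l s = Real.exp (S.logRatioSum s l) := by
  have hN : (0 : ℝ) < S.N l := by exact_mod_cast S.N_pos l
  rw [ratioSum, logRatioSum, Real.exp_add, Real.exp_log hN, Finset.sum_const, Finset.card_univ,
    Fintype.card_fin, nsmul_eq_mul, Real.rpow_def_of_pos (S.c_pos l), mul_comm s]

theorem measurable_logRatioSum (s : ℝ) : Measurable (S.logRatioSum s) :=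
  (Real.measurable_log.comp (measurable_from_nat.comp S.measurable_N)).add
    ((Real.measurable_log.comp S.measurable_c).const_mul s)

variable {S} {ω : ℕ → Λ}

theorem sum_logRatioSum (s : ℝ) {n q : ℕ} (hnq : n ≤ q) :
    ∑ j ∈ Finset.Ico n q, S.logRatioSum s (ω j) =
      Real.log ((S.numProd ω q : ℝ) / S.numProd ω n) -
        s * Real.log (S.ratioProd ω n / S.ratioProd ω q) := by
  rw [Real.log_div (numProd_cast_pos ω q).ne' (numProd_cast_pos ω n).ne',
    Real.log_div (S.ratioProd_pos ω n).ne' (S.ratioProd_pos ω q).ne']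
  induction q, hnq using Nat.le_induction with
  | base => simp
  | succ q hnq ih =>
    rw [Finset.sum_Ico_succ_top hnq, ih, logRatioSum, numProd_succ, ratioProd_succ, Nat.cast_mul,
      Real.log_mul (numProd_cast_pos ω q).ne' (by exact_mod_cast Nat.one_le_iff_ne_zero.mp (S.N_pos (ω q))),
      Real.log_mul (S.ratioProd_pos ω q).ne' (S.c_pos _).ne']
    ring

theorem numProd_div_le_of_sum_nonpos {s : ℝ} {n q : ℕ} (hnq : n ≤ q)
    (h : ∑ j ∈ Finset.Ico n q, S.logRatioSum s (ω j) ≤ 0) :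
    (S.numProd ω q : ℝ) / S.numProd ω n ≤ (S.ratioProd ω n / S.ratioProd ω q) ^ s := by
  have h1 := numProd_cast_pos (S := S) ω q
  have h2 := numProd_cast_pos (S := S) ω n
  have h3 := S.ratioProd_pos ω q
  have h4 := S.ratioProd_pos ω n
  rw [sum_logRatioSum s hnq] at h
  rw [← Real.log_le_log_iff (by positivity) (by positivity), Real.log_rpow (by positivity)]
  linarith

theorem le_numProd_div_of_sum_nonneg {s : ℝ} {n q : ℕ} (hnq : n ≤ q)
    (h : 0 ≤ ∑ j ∈ Finset.Ico n q, S.logRatioSum s (ω j)) :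
    (S.ratioProd ω n / S.ratioProd ω q) ^ s ≤ (S.numProd ω q : ℝ) / S.numProd ω n := by
  have h1 := numProd_cast_pos (S := S) ω q
  have h2 := numProd_cast_pos (S := S) ω n
  have h3 := S.ratioProd_pos ω q
  have h4 := S.ratioProd_pos ω n
  rw [sum_logRatioSum s hnq] at h
  rw [← Real.log_le_log_iff (by positivity) (by positivity), Real.log_rpow (by positivity)]
  linarith

variable (S ω) in
/-- Windows of levels `n, …, q - 1` that are at least logarithmically long in `n` have at most the
growth with exponent `s`. -/
def WindowUpperBound (s : ℝ) : Prop :=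
  ∃ K : ℝ, 0 < K ∧ ∀ᶠ n : ℕ in atTop, ∀ q : ℕ, n ≤ q → K * Real.log (n + 1) ≤ (q : ℝ) - n →
    (S.numProd ω q : ℝ) / S.numProd ω n ≤ (S.ratioProd ω n / S.ratioProd ω q) ^ s

variable (S ω) in
/-- Windows of levels `n, …, q - 1` that are at least logarithmically long in `n` have at least the
growth with exponent `s`. -/
def WindowLowerBound (s : ℝ) : Prop :=
  ∃ K : ℝ, 0 < K ∧ ∀ᶠ n : ℕ in atTop, ∀ q : ℕ, n ≤ q → K * Real.log (n + 1) ≤ (q : ℝ) - n →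
    (S.ratioProd ω n / S.ratioProd ω q) ^ s ≤ (S.numProd ω q : ℝ) / S.numProd ω n

/-- Used where an exponent just below s is negative and gets truncated to 0. -/
theorem windowLowerBound_zero : S.WindowLowerBound ω 0 := by
  refine ⟨1, one_pos, Eventually.of_forall fun n q hnq _ => ?_⟩
  rw [Real.rpow_zero, one_le_div (numProd_cast_pos ω n)]
  exact_mod_cast numProd_mono ω hnq

variable {A D : ℝ}

/-- All long windows starting from one fixed good level n₀ suffice; the first n₀ + p levels cost
only a constant. -/
theorem CoverBounds.exists_whole_le (hcov : S.CoverBounds ω A D) {s : ℝ} (hs : 0 ≤ s)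
    (hwin : S.WindowUpperBound ω s) : ∃ C : ℝ, 0 < C ∧ ∀ r : ℝ, 0 < r → r < 1 →
      coverNum r (S.attractor ω) ≤ ENNReal.ofReal (C * r ^ (-s)) := by
  obtain ⟨a, b, ha, hab, hb, hc⟩ := S.exists_c_bounds
  have hD := hcov.one_le_D
  obtain ⟨K, hK, hwin⟩ := hwin
  obtain ⟨n₀, hn₀⟩ := hwin.exists
  obtain ⟨p, hp⟩ := exists_nat_ge (K * Real.log (n₀ + 1))
  have hanti := ratioProd_strictAnti (S := S) hb (fun l => (hc l).2) ω
  have hN := numProd_cast_pos (S := S) ω (n₀ + p)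
  have hDa : 1 ≤ D / a ^ 2 := by
    rw [one_le_div (by positivity)]
    exact (pow_le_one₀ ha.le (hab.trans hb.le)).trans hD
  refine ⟨S.numProd ω (n₀ + p) * (D / a ^ 2) ^ s, by positivity, fun r hr hr1 => ?_⟩
  obtain ⟨n, q, hnq, hn1, hn2, hq, hle⟩ :=
    exists_levels (ω := ω) ha (fun l => (hc l).1) hD hr hr1.le le_rfl
  have hn0 : n = 0 := by
    by_contra h
    have := hanti (Nat.pos_of_ne_zero h)
    rw [ratioProd_zero] at this
    linarith
  subst hn0
  rw [ratioProd_zero] at hle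
  refine (hcov.le_whole q r hq).trans (ENNReal.ofReal_le_ofReal ?_)
  have hmain : (S.numProd ω q : ℝ) ≤ S.numProd ω (n₀ + p) * (D / a ^ 2 * (1 / r)) ^ s := by
    have h1r : 1 ≤ 1 / r := by rw [one_le_div hr]; exact hr1.le
    rcases le_total (n₀ + p) q with hqp | hqp
    · have h1 := hn₀ q (by omega) (hp.trans (by
        have : ((n₀ + p : ℕ) : ℝ) ≤ q := by exact_mod_cast hqp
        push_cast at this
        linarith))
      rw [div_le_iff₀ (numProd_cast_pos ω n₀), mul_comm] at h1
      refine h1.trans ?_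
      have h2 : S.ratioProd ω n₀ ≤ 1 := by
        rw [← S.ratioProd_zero ω]
        exact hanti.antitone (Nat.zero_le _)
      have h3 := S.ratioProd_pos ω q
      have h4 := S.ratioProd_pos ω n₀
      gcongr
      · exact_mod_cast numProd_mono ω (Nat.le_add_right _ _)
      · exact (div_le_div_of_nonneg_right h2 h3.le).trans hle
    · calc (S.numProd ω q : ℝ) ≤ S.numProd ω (n₀ + p) := by exact_mod_cast numProd_mono ω hqp
        _ ≤ _ := le_mul_of_one_le_right hN.le
            (Real.one_le_rpow (one_le_mul_of_one_le_of_one_le hDa h1r) hs)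
  refine hmain.trans (le_of_eq ?_)
  rw [Real.mul_rpow (by positivity) (by positivity), one_div, Real.inv_rpow hr.le,
    Real.rpow_neg hr.le, mul_assoc]

theorem CoverBounds.exists_le_whole (hcov : S.CoverBounds ω A D) {s : ℝ} (hs : 0 ≤ s)
    (hwin : S.WindowLowerBound ω s) : ∃ C : ℝ, 0 < C ∧ ∀ᶠ r : ℝ in 𝓝[>] 0,
      ENNReal.ofReal (C * r ^ (-s)) ≤ coverNum r (S.attractor ω) := by
  obtain ⟨a, b, ha, hab, hb, hc⟩ := S.exists_c_bounds
  have hA := hcov.one_le_A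
  obtain ⟨K, hK, hwin⟩ := hwin
  obtain ⟨n₀, hn₀⟩ := hwin.exists
  obtain ⟨p, hp⟩ := exists_nat_ge (K * Real.log (n₀ + 1))
  have hanti := ratioProd_strictAnti (S := S) hb (fun l => (hc l).2) ω
  have hcn := S.ratioProd_pos ω n₀
  obtain ⟨x, hx⟩ := S.attractor_nonempty ω
  refine ⟨(S.ratioProd ω n₀ * a) ^ s / A, by positivity, ?_⟩
  filter_upwards [self_mem_nhdsWithin,
    nhdsWithin_le_nhds (gt_mem_nhds (S.ratioProd_pos ω (n₀ + p)))] with r hr0 hr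
  have hr0 : 0 < r := hr0
  obtain ⟨q, hq, hq1, hq2⟩ := exists_level hr0 hr.le
  have h1 := hn₀ q (by omega) (hp.trans (by
    have : ((n₀ + p : ℕ) : ℝ) ≤ q := by exact_mod_cast hq
    push_cast at this
    linarith))
  refine le_trans ?_ ((hcov.le_ball n₀ q (by omega) x hx _ r le_rfl hr0.le hq2).trans
    (coverNum_mono Set.inter_subset_left))
  refine ENNReal.ofReal_le_ofReal ?_
  rw [div_mul_eq_mul_div]
  gcongr
  refine le_trans ?_ h1
  have hcq := S.ratioProd_pos ω q
  rw [Real.rpow_neg hr0.le, ← Real.inv_rpow hr0.le, ← Real.mul_rpow (by positivity) (by positivity)]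
  refine Real.rpow_le_rpow (by positivity) ?_ hs
  rw [← div_eq_mul_inv, div_le_div_iff₀ hr0 hcq, mul_assoc]
  gcongr
  rw [ratioProd_succ] at hq1
  nlinarith [(hc (ω q)).1]

/-- With u = |log R|, the level n of R satisfies nβ ≤ u < (n + 1)α and the window satisfies y ≤ (q -
n)α. So y ≥ 2Kα log u makes it long enough. -/
theorem CoverBounds.phiAssouadDim_le_of_window (hcov : S.CoverBounds ω A D) {s : ℝ} (hs : 0 ≤ s)
    (hwin : S.WindowUpperBound ω s) {ψ : ℝ → ℝ}
    (hψ : ∀ K : ℝ, ∀ᶠ x in 𝓝[>] 0, K * Real.log |Real.log x| ≤ ψ x * |Real.log x|) :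
    phiAssouadDim ψ (S.attractor ω) ≤ s := by
  obtain ⟨C, hC, hbox⟩ := hcov.exists_whole_le hs hwin
  refine hcov.phiAssouadDim_le hs hC hbox ?_
  obtain ⟨a, b, ha, hab, hb, hc⟩ := S.exists_c_bounds
  have hD := hcov.one_le_D
  obtain ⟨K, hK, hwin⟩ := hwin
  obtain ⟨n₀, hn₀⟩ := eventually_atTop.mp hwin
  have hα : 0 < -Real.log a := by linarith [Real.log_neg ha (hab.trans_lt hb)]
  have hβ : 0 < -Real.log b := by linarith [Real.log_neg (ha.trans_le hab) hb]
  set α := -Real.log a with hαdef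
  set β := -Real.log b with hβdef
  -- The first lower bound on |log R| forces n ≥ n₀; the second gives n + 1 ≤ u², hence log(n + 1) ≤
  -- 2 log u.
  filter_upwards [hψ (2 * K * α), self_mem_nhdsWithin,
    nhdsWithin_le_nhds (gt_mem_nhds (one_pos : (0 : ℝ) < 1)),
    tendsto_abs_log_nhdsGT_zero.eventually_gt_atTop
      (max ((n₀ + 1) * α) (β⁻¹ + 1))] with R hR hR0 hR1 hlog n q hnq hn1 hn2 hq
  have hR0 : 0 < R := hR0
  obtain ⟨hlog1, hlog2⟩ := max_lt_iff.mp hlog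
  rw [rpow_one_add_eq hR0 hR1] at hq
  set y := ψ R * |Real.log R| with hy
  have hu : |Real.log R| = -Real.log R := abs_of_neg (Real.log_neg hR0 hR1)
  set u := |Real.log R| with hudef
  have hcn := S.ratioProd_pos ω n
  have hcq := S.ratioProd_pos ω q
  have h1 : u < (n + 1) * α := by
    have h2 := (pow_mul_ratioProd_le (ω := ω) ha.le (fun l => (hc l).1)
      (Nat.zero_le (n + 1))).trans_lt hn1
    rw [ratioProd_zero, mul_one, Nat.sub_zero] at h2
    have h3 := Real.log_lt_log (by positivity) h2
    rw [Real.log_pow] at h3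
    push_cast at h3
    rw [hu]
    linarith
  have h2 : n * β ≤ u := by
    have h2 := hn2.trans (ratioProd_le_pow_mul (ω := ω) (ha.le.trans hab) (fun l => (hc l).2)
      (Nat.zero_le n))
    rw [ratioProd_zero, mul_one, Nat.sub_zero] at h2
    have h3 := Real.log_le_log hR0 h2
    rw [Real.log_pow] at h3
    rw [hu]
    linarith
  have hn : n₀ ≤ n := by
    have : ((n₀ : ℝ) + 1) < n + 1 := lt_of_mul_lt_mul_right (hlog1.trans h1) hα.le
    have : (n₀ : ℝ) < n := by linarith
    exact_mod_cast this.le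
  refine hn₀ n hn q hnq ?_
  have hu1 : 1 < u := by
    have : 0 < β⁻¹ := by positivity
    linarith
  have h3 : Real.log (n + 1) ≤ 2 * Real.log u := by
    have h4 : (n : ℝ) + 1 ≤ u ^ 2 := by
      have h5 : (n : ℝ) ≤ β⁻¹ * u := by
        rw [inv_mul_eq_div, le_div_iff₀ hβ]
        exact h2
      nlinarith
    have := Real.log_le_log (by positivity) h4
    rwa [Real.log_pow] at this
  have h4 : y ≤ (q - n) * α := by
    have h5 : a ^ (q - n) * S.ratioProd ω n ≤ Real.exp (-y) * S.ratioProd ω n := by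
      calc a ^ (q - n) * S.ratioProd ω n ≤ S.ratioProd ω q :=
            pow_mul_ratioProd_le ha.le (fun l => (hc l).1) hnq
        _ ≤ D * S.ratioProd ω q := le_mul_of_one_le_left hcq.le hD
        _ ≤ R * Real.exp (-y) := hq
        _ ≤ S.ratioProd ω n * Real.exp (-y) := by gcongr
        _ = _ := mul_comm _ _
    have h6 := Real.log_le_log (by positivity) (le_of_mul_le_mul_right h5 hcn)
    rw [Real.log_pow, Real.log_exp, Nat.cast_sub hnq] at h6
    linarith
  have h5 : K * Real.log (n + 1) * α ≤ (q - n) * α := by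
    refine le_trans ?_ (hR.trans h4)
    have := mul_le_mul_of_nonneg_left h3 (mul_pos hK hα).le
    linarith
  exact le_of_mul_le_mul_right h5 hα

theorem CoverBounds.le_phiAssouadDim_of_window (hcov : S.CoverBounds ω A D) {s : ℝ} (hs : 0 ≤ s)
    (hwin : S.WindowLowerBound ω s) {ψ : ℝ → ℝ}
    (hψ : ∀ K : ℝ, ∀ᶠ x in 𝓝[>] 0, K * Real.log |Real.log x| ≤ ψ x * |Real.log x|) :
    (s : EReal) ≤ phiAssouadDim ψ (S.attractor ω) := by
  have hloglog : Tendsto (fun x : ℝ => Real.log |Real.log x|) (𝓝[>] 0) atTop :=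
    Real.tendsto_log_atTop.comp tendsto_abs_log_nhdsGT_zero
  have hD := hcov.one_le_D
  refine hcov.le_phiAssouadDim hs (tendsto_atTop_mono' _ ((hψ 1).mono fun x hx => by
    rwa [one_mul] at hx) hloglog) (Eventually.frequently ?_)
  obtain ⟨a, b, ha, hab, hb, hc⟩ := S.exists_c_bounds
  obtain ⟨K, hK, hwin⟩ := hwin
  have hα : 0 < -Real.log a := by linarith [Real.log_neg ha (hab.trans_lt hb)]
  have hβ : 0 < -Real.log b := by linarith [Real.log_neg (ha.trans_le hab) hb]
  set α := -Real.log a with hαdef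
  set β := -Real.log b with hβdef
  have hR0 : ∀ n, 0 < D * S.ratioProd ω n := fun n => by
    have := S.ratioProd_pos ω n
    positivity
  have htend : Tendsto (fun n => D * S.ratioProd ω n) atTop (𝓝[>] 0) := by
    refine tendsto_nhdsWithin_iff.mpr ⟨?_, Eventually.of_forall hR0⟩
    simpa using (S.tendsto_ratioProd ω).const_mul D
  -- Here r is only known to exceed the ratio of level q + 1, and R carries the factor D, so y ≤ (q
  -- - n)α + α + log D. The extra 1 in 2Kα + 1 absorbs α + log D once log|log R| exceeds it.
  filter_upwards [hwin, htend.eventually (hψ (2 * K * α + 1)),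
    htend.eventually (nhdsWithin_le_nhds (gt_mem_nhds (one_pos : (0 : ℝ) < 1))),
    (tendsto_abs_log_nhdsGT_zero.comp htend).eventually_gt_atTop
      (max (2 * β⁻¹ + 1) (Real.log D)),
    (hloglog.comp htend).eventually_ge_atTop (Real.log D + α)] with n hn hR hR1 hlog hll q hnq hq1 _
  obtain ⟨hlog1, hlog2⟩ := max_lt_iff.mp hlog
  rw [rpow_one_add_eq (hR0 n) hR1] at hq1
  simp only [Function.comp] at hlog1 hlog2 hll
  have hu : |Real.log (D * S.ratioProd ω n)| = -Real.log (D * S.ratioProd ω n) :=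
    abs_of_neg (Real.log_neg (hR0 n) hR1)
  set y := ψ (D * S.ratioProd ω n) * |Real.log (D * S.ratioProd ω n)| with hy
  set u := |Real.log (D * S.ratioProd ω n)| with hudef
  have hcn := S.ratioProd_pos ω n
  have hD0 : 0 < D := by linarith
  have h2 : n * β ≤ 2 * u := by
    have h2 := ratioProd_le_pow_mul (ω := ω) (ha.le.trans hab) (fun l => (hc l).2)
      (Nat.zero_le n)
    rw [ratioProd_zero, mul_one, Nat.sub_zero] at h2
    have h3 := Real.log_le_log hcn h2
    rw [Real.log_pow] at h3
    rw [Real.log_mul hD0.ne' hcn.ne'] at hu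
    linarith
  refine hn q hnq ?_
  have hu1 : 1 < u := by
    have : 0 < β⁻¹ := by positivity
    linarith
  have h3 : Real.log (n + 1) ≤ 2 * Real.log u := by
    have h4 : (n : ℝ) + 1 ≤ u ^ 2 := by
      have h5 : (n : ℝ) ≤ 2 * β⁻¹ * u := by
        rw [mul_right_comm, ← div_eq_mul_inv, le_div_iff₀ hβ]
        exact h2
      nlinarith
    have := Real.log_le_log (by positivity) h4
    rwa [Real.log_pow] at this
  have h4 : y - Real.log D ≤ (q - n) * α + α := by
    have h5 : a ^ (q + 1 - n) * S.ratioProd ω n ≤ D * Real.exp (-y) * S.ratioProd ω n := by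
      calc a ^ (q + 1 - n) * S.ratioProd ω n ≤ S.ratioProd ω (q + 1) :=
            pow_mul_ratioProd_le ha.le (fun l => (hc l).1) (by omega)
        _ ≤ D * S.ratioProd ω n * Real.exp (-y) := hq1.le
        _ = _ := by ring
    have h6 := Real.log_le_log (by positivity) (le_of_mul_le_mul_right h5 hcn)
    rw [Real.log_pow, Real.log_mul hD0.ne' (Real.exp_pos _).ne', Real.log_exp,
      Nat.cast_sub (by omega)] at h6
    push_cast at h6
    linarith
  have h5 : K * Real.log (n + 1) * α ≤ (q - n) * α := by
    have := mul_le_mul_of_nonneg_left h3 (mul_pos hK hα).le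
    linarith
  exact le_of_mul_le_mul_right h5 hα

/-- A run exists for every large L, and the bound on ψ holds on a whole range of x above e^{-k}. So
infinitely many k are enough: each one selects an L whose run begins at a radius in that range. -/
theorem CoverBounds.le_phiAssouadDim_of_runs (hcov : S.CoverBounds ω A D) {s : ℝ} (hs : 0 ≤ s)
    {a b : ℝ} (ha : 0 < a) (hab : a ≤ b) (hb : b < 1) (hc : ∀ l, a ≤ S.c l ∧ S.c l ≤ b)
    {M p : ℕ} (hM : 2 ≤ M) (hp : 0 < p) (hap : -Real.log a ≤ p)
    (hrun : ∀ᶠ L : ℕ in atTop, ∃ n : ℕ, L ≤ n ∧ n ≤ M ^ L ∧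
      ∀ j < L, 0 ≤ S.logRatioSum s (ω (n + j)))
    {ψ : ℝ → ℝ} (hψ : Tendsto (fun x => ψ x * |Real.log x|) (𝓝[>] 0) atTop)
    {δ : ℝ} (hδ : 0 < δ) (hδ1 : δ ≤ 1)
    (hfreq : ∃ᶠ k : ℕ in atTop, ∀ x, Real.exp (-k) ≤ x → x < δ →
      ψ x * |Real.log x| ≤ -Real.log b / (Real.log p + 2 * Real.log M) * Real.log k) :
    (s : EReal) ≤ phiAssouadDim ψ (S.attractor ω) := by
  refine hcov.le_phiAssouadDim hs hψ (frequently_atTop.mpr fun n₀ => ?_)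
  have hD := hcov.one_le_D
  have hD0 : 0 < D := by linarith
  have hβ : 0 < -Real.log b := by linarith [Real.log_neg (ha.trans_le hab) hb]
  have hsmall : ∀ᶠ n in atTop, D * S.ratioProd ω n < δ := by
    have : Tendsto (fun n => D * S.ratioProd ω n) atTop (𝓝 0) := by
      simpa using (S.tendsto_ratioProd ω).const_mul D
    exact this.eventually (gt_mem_nhds hδ)
  obtain ⟨n₁, hn₁⟩ := eventually_atTop.mp hsmall
  obtain ⟨L₀, hL₀⟩ := eventually_atTop.mp hrun
  set L₁ := max (max n₀ n₁) (max L₀ 1) with hL₁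
  obtain ⟨k, hk, hkL⟩ := (frequently_atTop.mp hfreq (p * M ^ L₁))
  -- The largest L with p M^L ≤ k. A run starting at n ≤ M^L has a^n ≥ e^{-k}, and maximality gives
  -- log k ≤ L(log p + 2 log M). Hence y ≤ L(-log b), and the window has at most L levels and stays
  -- in the run.
  set L := Nat.log M (k / p) with hL
  have hMpos : 0 < M := by omega
  have hkp : M ^ L₁ ≤ k / p := (Nat.le_div_iff_mul_le hp).mpr (by linarith)
  have hkp0 : k / p ≠ 0 := by
    have : 0 < M ^ L₁ := by positivity
    omega
  have hLL : L₁ ≤ L := Nat.le_log_of_pow_le (by omega) hkp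
  have hML : p * M ^ L ≤ k := by
    have := Nat.pow_log_le_self M hkp0
    exact (Nat.mul_le_mul_left p this).trans (Nat.mul_div_le k p)
  have hkM : k < p * M ^ (L + 1) := by
    have h1 : k / p < M ^ (L + 1) := Nat.lt_pow_succ_log_self (by omega) _
    rwa [Nat.div_lt_iff_lt_mul hp, mul_comm] at h1
  have hL1 : 1 ≤ L := le_trans (by simp [hL₁]) hLL
  obtain ⟨n, hLn, hnM, hn⟩ := hL₀ L (le_trans (by simp [hL₁]) hLL)
  refine ⟨n, le_trans (le_trans (by simp [hL₁]) hLL) hLn, fun q hnq _ hq => ?_⟩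
  have hRδ := hn₁ n (le_trans (le_trans (by simp [hL₁]) hLL) hLn)
  have hcn := S.ratioProd_pos ω n
  have hR0 : 0 < D * S.ratioProd ω n := by positivity
  rw [rpow_one_add_eq hR0 (hRδ.trans_le hδ1)] at hq
  have hkR : Real.exp (-k) ≤ D * S.ratioProd ω n := by
    have h1 := pow_mul_ratioProd_le (ω := ω) ha.le (fun l => (hc l).1) (Nat.zero_le n)
    rw [ratioProd_zero, mul_one, Nat.sub_zero] at h1
    refine le_trans ?_ (h1.trans (le_mul_of_one_le_left hcn.le hD))
    rw [← Real.exp_log ha, ← Real.exp_nat_mul]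
    refine Real.exp_le_exp.mpr ?_
    have h2 : (p : ℝ) * M ^ L ≤ k := by exact_mod_cast hML
    have h3 : (n : ℝ) ≤ M ^ L := by exact_mod_cast hnM
    have h4 : (n : ℝ) * -Real.log a ≤ M ^ L * p := by
      have : 0 ≤ -Real.log a := by linarith [Real.log_neg ha (hab.trans_lt hb)]
      gcongr
    linarith
  have hy := hkL _ hkR hRδ
  set y := ψ (D * S.ratioProd ω n) * |Real.log (D * S.ratioProd ω n)|
  have hlogM : 0 < Real.log M := Real.log_pos (by exact_mod_cast (show 1 < M by omega))
  have hlogp : 0 ≤ Real.log p := Real.log_nonneg (by exact_mod_cast hp)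
  have hk0 : 0 < k := lt_of_lt_of_le (by positivity) hk
  have hlogk : Real.log k ≤ L * (Real.log p + 2 * Real.log M) := by
    have h1 : (k : ℝ) ≤ p * M ^ (L + 1) := by exact_mod_cast hkM.le
    have h2 := Real.log_le_log (by positivity) h1
    rw [Real.log_mul (by positivity) (by positivity), Real.log_pow] at h2
    push_cast at h2
    have h3 : (1 : ℝ) ≤ L := by exact_mod_cast hL1
    nlinarith
  have hyL : y ≤ L * -Real.log b := by
    refine hy.trans ?_
    rw [div_mul_eq_mul_div, div_le_iff₀ (by positivity)]
    nlinarith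
  have hqL : q - n ≤ L := by
    have h1 : Real.exp (-y) * S.ratioProd ω n ≤ b ^ (q - n) * S.ratioProd ω n := by
      calc Real.exp (-y) * S.ratioProd ω n
          ≤ D * (Real.exp (-y) * S.ratioProd ω n) := le_mul_of_one_le_left (by positivity) hD
        _ = D * S.ratioProd ω n * Real.exp (-y) := by ring
        _ ≤ S.ratioProd ω q := hq
        _ ≤ _ := ratioProd_le_pow_mul (ha.le.trans hab) (fun l => (hc l).2) hnq
    have h2 := Real.log_le_log (by positivity) (le_of_mul_le_mul_right h1 hcn)
    rw [Real.log_exp, Real.log_pow] at h2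
    have h3 : ((q - n : ℕ) : ℝ) * -Real.log b ≤ L * -Real.log b := by linarith
    exact_mod_cast le_of_mul_le_mul_right h3 hβ
  refine le_numProd_div_of_sum_nonneg hnq (Finset.sum_nonneg fun j hj => ?_)
  rw [Finset.mem_Ico] at hj
  have := hn (j - n) (by omega)
  rwa [Nat.add_sub_cancel' hj.1] at this

end HomogeneousFamily

/-! ### Almost sure exponents and dimensions. -/

theorem ereal_le_of_forall_le_add_one_div {x : EReal} {s : ℝ}
    (h : ∀ k : ℕ, x ≤ ((s + 1 / ((k : ℝ) + 1) : ℝ) : EReal)) : x ≤ s := by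
  refine EReal.le_of_forall_lt_iff_le.mp fun z hz => ?_
  have hz : s < z := by exact_mod_cast hz
  obtain ⟨k, hk⟩ := exists_nat_one_div_lt (sub_pos.mpr hz)
  refine (h k).trans ?_
  exact_mod_cast (by linarith : s + 1 / ((k : ℝ) + 1) ≤ z)

theorem ereal_le_of_forall_max_sub_one_div_le {x : EReal} {s : ℝ}
    (h : ∀ k : ℕ, ((max 0 (s - 1 / ((k : ℝ) + 1)) : ℝ) : EReal) ≤ x) : (s : EReal) ≤ x := by
  refine EReal.ge_of_forall_gt_iff_ge.mp fun z hz => ?_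
  have hz : z < s := by exact_mod_cast hz
  obtain ⟨k, hk⟩ := exists_nat_one_div_lt (sub_pos.mpr hz)
  refine le_trans ?_ (h k)
  have : z ≤ max 0 (s - 1 / ((k : ℝ) + 1)) := le_max_of_le_right (by linarith)
  exact_mod_cast this

/-- φ = o(ψ) upgrades the constant ½ available for φ to an arbitrary K. -/
theorem eventually_mul_log_abs_log_le {φ ψ : ℝ → ℝ} (hφ : IsDimensionFunction φ)
    (hsum : SumConverges φ) (hψ : IsDimensionFunction ψ) (hφψ : φ =o[𝓝[>] 0] ψ) (K : ℝ) :
    ∀ᶠ x in 𝓝[>] 0, K * Real.log |Real.log x| ≤ ψ x * |Real.log x| := by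
  obtain ⟨δ, hδ, -, hpos, -⟩ := hψ
  have hK : 0 < max K 1 := lt_max_of_lt_right one_pos
  filter_upwards [eventually_log_abs_log_le hφ hsum,
    hφψ.bound (show 0 < (2 * max K 1)⁻¹ by positivity), Ioo_mem_nhdsGT hδ,
    tendsto_abs_log_nhdsGT_zero.eventually_ge_atTop 1] with x h1 h2 h3 h4
  have h5 : φ x ≤ (2 * max K 1)⁻¹ * ψ x := by
    have := (le_abs_self (φ x)).trans h2
    rwa [Real.norm_of_nonneg (hpos x h3).le] at this
  rw [inv_mul_eq_div, le_div_iff₀ (by positivity)] at h5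
  calc K * Real.log |Real.log x| ≤ max K 1 * Real.log |Real.log x| :=
        mul_le_mul_of_nonneg_right (le_max_left _ _) (Real.log_nonneg h4)
    _ ≤ max K 1 * (2 * (φ x * |Real.log x|)) := mul_le_mul_of_nonneg_left h1 hK.le
    _ = φ x * (2 * max K 1) * |Real.log x| := by ring
    _ ≤ _ := mul_le_mul_of_nonneg_right h5 (by linarith)

namespace HomogeneousFamily

variable {Λ : Type*} [MeasurableSpace Λ] {d : ℕ} (S : HomogeneousFamily Λ d)

theorem abs_log_N_le : ∃ B : ℝ, ∀ l, |Real.log (S.N l)| ≤ B := by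
  obtain ⟨M, hM⟩ := S.N_bdd
  refine ⟨Real.log M, fun l => ?_⟩
  have h1 : (1 : ℝ) ≤ S.N l := by exact_mod_cast S.N_pos l
  rw [abs_of_nonneg (Real.log_nonneg h1)]
  exact Real.log_le_log (by linarith) (by exact_mod_cast hM l)

theorem abs_log_c_le : ∃ B : ℝ, ∀ l, |Real.log (S.c l)| ≤ B := by
  obtain ⟨a, b, ha, hab, hb, h⟩ := S.exists_c_bounds
  refine ⟨-Real.log a, fun l => ?_⟩
  rw [abs_of_neg (Real.log_neg (S.c_pos l) ((h l).2.trans_lt hb))]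
  exact neg_le_neg (Real.log_le_log ha (h l).1)

theorem abs_logRatioSum_le (s : ℝ) : ∃ B : ℝ, ∀ l, |S.logRatioSum s l| ≤ B := by
  obtain ⟨B₁, h₁⟩ := S.abs_log_N_le
  obtain ⟨B₂, h₂⟩ := S.abs_log_c_le
  refine ⟨B₁ + |s| * B₂, fun l => (abs_add_le _ _).trans (add_le_add (h₁ l) ?_)⟩
  rw [abs_mul]
  exact mul_le_mul_of_nonneg_left (h₂ l) (abs_nonneg s)

section Almost

variable (μ : Measure Λ) [IsProbabilityMeasure μ]

theorem ae_windowUpperBound {s : ℝ} (h : ∫ l, S.logRatioSum s l ∂μ < 0) :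
    ∀ᵐ ω ∂(Measure.infinitePi fun _ : ℕ => μ), S.WindowUpperBound ω s := by
  obtain ⟨B, hB⟩ := S.abs_logRatioSum_le s
  obtain ⟨K, hK, hae⟩ :=
    exists_ae_eventually_window_sum_neg μ (S.measurable_logRatioSum s) hB h
  filter_upwards [hae] with ω hω
  refine ⟨K, hK, hω.mono fun n hn q hnq hq => numProd_div_le_of_sum_nonpos hnq ?_⟩
  have := hn (q - n) (by rwa [Nat.cast_sub hnq])
  rw [Nat.add_sub_cancel' hnq] at this
  exact this.le

theorem ae_windowLowerBound {s : ℝ} (h : 0 < ∫ l, S.logRatioSum s l ∂μ) :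
    ∀ᵐ ω ∂(Measure.infinitePi fun _ : ℕ => μ), S.WindowLowerBound ω s := by
  obtain ⟨B, hB⟩ := S.abs_logRatioSum_le s
  obtain ⟨K, hK, hae⟩ :=
    exists_ae_eventually_window_sum_neg μ (S.measurable_logRatioSum s).neg (B := B)
      (fun l => by simpa using hB l) (by simpa [integral_neg] using h)
  filter_upwards [hae] with ω hω
  refine ⟨K, hK, hω.mono fun n hn q hnq hq => le_numProd_div_of_sum_nonneg hnq ?_⟩
  have := hn (q - n) (by rwa [Nat.cast_sub hnq])
  rw [Nat.add_sub_cancel' hnq] at this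
  simp only [Pi.neg_apply, Finset.sum_neg_distrib] at this
  linarith

/-- The mean of log 𝔖^s is affine in s with negative slope, and s = E log N / (-E log c) is its
zero. Countably many nearby exponents share one almost sure event. -/
theorem exists_ae_windowBounds : ∃ s : ℝ, 0 ≤ s ∧
    ∀ᵐ ω ∂(Measure.infinitePi fun _ : ℕ => μ), ∀ k : ℕ,
      S.WindowUpperBound ω (s + 1 / ((k : ℝ) + 1)) ∧
        S.WindowLowerBound ω (max 0 (s - 1 / ((k : ℝ) + 1))) := by
  obtain ⟨a, b, ha, hab, hb, hc⟩ := S.exists_c_bounds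
  obtain ⟨B₁, h₁⟩ := S.abs_log_N_le
  obtain ⟨B₂, h₂⟩ := S.abs_log_c_le
  have hmN : Measurable fun l => Real.log (S.N l) :=
    Real.measurable_log.comp (measurable_from_nat.comp S.measurable_N)
  have hmc : Measurable fun l => Real.log (S.c l) := Real.measurable_log.comp S.measurable_c
  have hiN : Integrable (fun l => Real.log (S.N l)) μ :=
    Integrable.of_bound hmN.aestronglyMeasurable B₁ (ae_of_all _ h₁)
  have hic : Integrable (fun l => Real.log (S.c l)) μ :=
    Integrable.of_bound hmc.aestronglyMeasurable B₂ (ae_of_all _ h₂)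
  set u := ∫ l, Real.log (S.N l) ∂μ with hu
  set v := ∫ l, Real.log (S.c l) ∂μ with hv
  have hlogb : Real.log b < 0 := Real.log_neg (ha.trans_le hab) hb
  have hv0 : v < 0 := by
    have : v ≤ ∫ _, Real.log b ∂μ := integral_mono hic (integrable_const _) fun l =>
      Real.log_le_log (S.c_pos l) (hc l).2
    rw [integral_const, probReal_univ, one_smul] at this
    linarith
  have hu0 : 0 ≤ u := integral_nonneg fun l =>
    Real.log_nonneg (by exact_mod_cast S.N_pos l)
  have hint : ∀ s, ∫ l, S.logRatioSum s l ∂μ = u + s * v := fun s => by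
    unfold logRatioSum
    rw [integral_add hiN (hic.const_mul s), integral_const_mul]
  have hs : u + u / -v * v = 0 := by
    rw [div_neg, neg_mul, div_mul_cancel₀ _ hv0.ne, add_neg_cancel]
  refine ⟨u / -v, div_nonneg hu0 (by linarith), ae_all_iff.mpr fun k => ?_⟩
  have hk : (0 : ℝ) < 1 / ((k : ℝ) + 1) := by positivity
  refine (S.ae_windowUpperBound μ ?_).and ?_
  · rw [hint]
    nlinarith
  · rcases max_cases 0 (u / -v - 1 / ((k : ℝ) + 1)) with ⟨h, -⟩ | ⟨h, -⟩ <;> rw [h]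
    · exact ae_of_all _ fun ω => windowLowerBound_zero
    · refine S.ae_windowLowerBound μ ?_
      rw [hint]
      nlinarith

variable {S}

theorem ae_hasBoxDim_phiAssouadDim (hS : S.UniformOSC) :
    ∀ᵐ ω ∂(Measure.infinitePi fun _ : ℕ => μ), ∀ ψ : ℝ → ℝ,
      (∀ K : ℝ, ∀ᶠ x in 𝓝[>] 0, K * Real.log |Real.log x| ≤ ψ x * |Real.log x|) →
        HasBoxDim (S.attractor ω) (phiAssouadDim ψ (S.attractor ω)) := by
  obtain ⟨A, D, hcov⟩ := hS.exists_coverBounds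
  obtain ⟨s, hs, hae⟩ := S.exists_ae_windowBounds μ
  filter_upwards [hae] with ω hω ψ hψ
  have hs' : ∀ k : ℕ, 0 ≤ s + 1 / ((k : ℝ) + 1) := fun k => by positivity
  have hphi : phiAssouadDim ψ (S.attractor ω) = s := le_antisymm
    (ereal_le_of_forall_le_add_one_div fun k =>
      (hcov ω).phiAssouadDim_le_of_window (hs' k) (hω k).1 hψ)
    (ereal_le_of_forall_max_sub_one_div_le fun k =>
      (hcov ω).le_phiAssouadDim_of_window (le_max_left _ _) (hω k).2 hψ)
  have hlower : (s : EReal) ≤ lowerBoxDim (S.attractor ω) :=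
    ereal_le_of_forall_max_sub_one_div_le fun k => by
      obtain ⟨C, hC, h⟩ := (hcov ω).exists_le_whole (le_max_left _ _) (hω k).2
      exact le_lowerBoxDim hC h
  have hupper : upperBoxDim (S.attractor ω) ≤ s :=
    ereal_le_of_forall_le_add_one_div fun k => by
      obtain ⟨C, hC, h⟩ := (hcov ω).exists_whole_le (hs' k) (hω k).1
      refine upperBoxDim_le hC ?_
      filter_upwards [Ioo_mem_nhdsGT one_pos] with r hr
      exact h r hr.1 hr.2
  have hle := lowerBoxDim_le_upperBoxDim (S.attractor ω)
  rw [hphi]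
  exact ⟨le_antisymm (hle.trans hupper) hlower, le_antisymm hupper (hlower.trans hle)⟩

/-- The run event involves neither ψ nor δ. The constant depends on M, hence on the measure of the
set of good parameters. -/
theorem exists_ae_le_phiAssouadDim (hS : S.UniformOSC) {s : ℝ} (hs : 0 ≤ s)
    (hpos : 0 < μ {l | 0 ≤ S.logRatioSum s l}) :
    ∃ C : ℝ, 0 < C ∧ ∀ᵐ ω ∂(Measure.infinitePi fun _ : ℕ => μ), ∀ ψ : ℝ → ℝ,
      Tendsto (fun x => ψ x * |Real.log x|) (𝓝[>] 0) atTop → ∀ δ : ℝ, 0 < δ → δ ≤ 1 →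
        (∃ᶠ k : ℕ in atTop, ∀ x, Real.exp (-k) ≤ x → x < δ →
          ψ x * |Real.log x| ≤ 2 * C * Real.log k) →
        (s : EReal) ≤ phiAssouadDim ψ (S.attractor ω) := by
  obtain ⟨A, D, hcov⟩ := hS.exists_coverBounds
  obtain ⟨a, b, ha, hab, hb, hc⟩ := S.exists_c_bounds
  obtain ⟨M, hM, hae⟩ := exists_ae_eventually_run μ
    (measurableSet_le measurable_const (S.measurable_logRatioSum s)) hpos
  obtain ⟨p, hp⟩ := exists_nat_ge (-Real.log a)
  have hp0 : 0 < p := by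
    have : (0 : ℝ) < p := lt_of_lt_of_le (by linarith [Real.log_neg ha (hab.trans_lt hb)]) hp
    exact_mod_cast this
  have hβ : 0 < -Real.log b := by linarith [Real.log_neg (ha.trans_le hab) hb]
  have hlogM : 0 < Real.log M := Real.log_pos (by exact_mod_cast (show 1 < M by omega))
  have hlogp : 0 ≤ Real.log p := Real.log_nonneg (by exact_mod_cast hp0)
  refine ⟨-Real.log b / (Real.log p + 2 * Real.log M) / 2, by positivity, ?_⟩
  filter_upwards [hae] with ω hω ψ hψ δ hδ hδ1 hfreq
  rw [mul_div_cancel₀ _ two_ne_zero] at hfreq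
  exact (hcov ω).le_phiAssouadDim_of_runs hs ha hab hb hc hM hp0 hp hω hψ hδ hδ1 hfreq

/-- The function ψ(x) = 2C log|log x| / |log x| saturates the admissible growth, and every
ψ-dimension bounds the Assouad dimension from below. -/
theorem ae_le_assouadDim (hS : S.UniformOSC) {s : ℝ} (hs : 0 ≤ s)
    (hpos : 0 < μ {l | 0 ≤ S.logRatioSum s l}) :
    ∀ᵐ ω ∂(Measure.infinitePi fun _ : ℕ => μ), (s : EReal) ≤ assouadDim (S.attractor ω) := by
  obtain ⟨C, hC, hae⟩ := exists_ae_le_phiAssouadDim μ hS hs hpos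
  filter_upwards [hae] with ω hω
  set ψ : ℝ → ℝ := fun x => 2 * C * Real.log |Real.log x| / |Real.log x|
  have hψ : ∀ x, 0 < x → x < 1 → ψ x * |Real.log x| = 2 * C * Real.log |Real.log x| :=
    fun x hx0 hx1 => div_mul_cancel₀ _ (abs_pos.mpr (Real.log_neg hx0 hx1).ne).ne'
  refine (hω ψ ?_ 1 one_pos le_rfl ?_).trans (phiAssouadDim_le_assouadDim ψ _)
  · refine Tendsto.congr' ?_ (Tendsto.const_mul_atTop (show 0 < 2 * C by positivity)
      (Real.tendsto_log_atTop.comp tendsto_abs_log_nhdsGT_zero))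
    filter_upwards [Ioo_mem_nhdsGT one_pos] with x hx
    exact (hψ x hx.1 hx.2).symm
  · refine (Eventually.of_forall fun k x hkx hx1 => ?_).frequently
    have hx0 := (Real.exp_pos _).trans_le hkx
    rw [hψ x hx0 hx1]
    have hneg := Real.log_neg hx0 hx1
    have hlog : |Real.log x| ≤ k := by
      rw [abs_of_neg hneg]
      linarith [(Real.le_log_iff_exp_le hx0).mpr hkx]
    gcongr
    exact abs_pos.mpr hneg.ne

variable (S) in
/-- The essential supremum of the similarity dimensions, which is the almost sure value of the
Assouad dimension. -/
theorem exists_essSup_exponent : ∃ s : ℝ, 0 ≤ s ∧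
    (∀ t, s < t → ∀ᵐ l ∂μ, S.logRatioSum t l ≤ 0) ∧
    ∀ k : ℕ, 0 < μ {l | 0 ≤ S.logRatioSum (max 0 (s - 1 / ((k : ℝ) + 1))) l} := by
  obtain ⟨a, b, ha, hab, hb, hc⟩ := S.exists_c_bounds
  obtain ⟨B, hB⟩ := S.abs_log_N_le
  have hlogb : Real.log b < 0 := Real.log_neg (ha.trans_le hab) hb
  have hc0 : ∀ l, Real.log (S.c l) ≤ Real.log b := fun l => Real.log_le_log (S.c_pos l) (hc l).2
  set E : Set ℝ := {t | 0 ≤ t ∧ ∀ᵐ l ∂μ, S.logRatioSum t l ≤ 0} with hE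
  have hbdd : BddBelow E := ⟨0, fun t ht => ht.1⟩
  have hne : E.Nonempty := by
    refine ⟨|B| / -Real.log b, div_nonneg (abs_nonneg _) (by linarith), ae_of_all _ fun l => ?_⟩
    have h1 : |B| / -Real.log b * Real.log (S.c l) ≤ |B| / -Real.log b * Real.log b :=
      mul_le_mul_of_nonneg_left (hc0 l) (div_nonneg (abs_nonneg _) (by linarith))
    have h2 : |B| / -Real.log b * Real.log b = -|B| := by
      rw [div_neg, neg_mul, div_mul_cancel₀ _ hlogb.ne]
    have h3 := (le_abs_self _).trans ((hB l).trans (le_abs_self B))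
    unfold logRatioSum
    linarith
  refine ⟨sInf E, le_csInf hne fun t ht => ht.1, fun t ht => ?_, fun k => ?_⟩
  · obtain ⟨t', ht', htt⟩ := exists_lt_of_csInf_lt hne ht
    filter_upwards [ht'.2] with l hl
    refine le_trans ?_ hl
    have := hc0 l
    unfold logRatioSum
    nlinarith
  · rcases max_cases 0 (sInf E - 1 / ((k : ℝ) + 1)) with ⟨h, -⟩ | ⟨h, h'⟩ <;> rw [h]
    · have : {l | 0 ≤ S.logRatioSum 0 l} = Set.univ := by
        ext l
        simp only [logRatioSum, zero_mul, add_zero, Set.mem_ofPred_eq, Set.mem_univ, iff_true]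
        exact Real.log_nonneg (by exact_mod_cast S.N_pos l)
      rw [this, measure_univ]
      exact one_pos
    · rw [pos_iff_ne_zero]
      intro h0
      have hmem : sInf E - 1 / ((k : ℝ) + 1) ∈ E := by
        refine ⟨h'.le, ?_⟩
        filter_upwards [measure_eq_zero_iff_ae_notMem.mp h0] with l hl
        exact (not_le.mp hl).le
      have := csInf_le hbdd hmem
      have hk : (0 : ℝ) < 1 / ((k : ℝ) + 1) := by positivity
      linarith

/-- For the upper bound, almost surely every single coordinate has 𝔖^t ≤ 1, so all windows do,
whatever their length. -/
theorem ae_assouadDim_eq (hS : S.UniformOSC) {s : ℝ} (hs : 0 ≤ s)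
    (hupper : ∀ t, s < t → ∀ᵐ l ∂μ, S.logRatioSum t l ≤ 0)
    (hlower : ∀ k : ℕ, 0 < μ {l | 0 ≤ S.logRatioSum (max 0 (s - 1 / ((k : ℝ) + 1))) l}) :
    ∀ᵐ ω ∂(Measure.infinitePi fun _ : ℕ => μ), assouadDim (S.attractor ω) = s := by
  obtain ⟨A, D, hcov⟩ := hS.exists_coverBounds
  have h1 : ∀ᵐ ω ∂(Measure.infinitePi fun _ : ℕ => μ), ∀ k j : ℕ,
      S.logRatioSum (s + 1 / ((k : ℝ) + 1)) (ω j) ≤ 0 := by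
    refine ae_all_iff.mpr fun k => ae_all_iff.mpr fun j => ?_
    have hk : (0 : ℝ) < 1 / ((k : ℝ) + 1) := by positivity
    exact (measurePreserving_eval_infinitePi (fun _ : ℕ => μ) j).quasiMeasurePreserving.ae
      (hupper _ (by linarith))
  have h2 := ae_all_iff.mpr fun k => ae_le_assouadDim μ hS (le_max_left _ _) (hlower k)
  filter_upwards [h1, h2] with ω hω1 hω2
  refine le_antisymm (ereal_le_of_forall_le_add_one_div fun k => ?_)
    (ereal_le_of_forall_max_sub_one_div_le hω2)
  exact (hcov ω).assouadDim_le (by positivity) fun n q hnq =>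
    numProd_div_le_of_sum_nonpos hnq (Finset.sum_nonpos fun j _ => hω1 k j)

end Almost

end HomogeneousFamily

end OneVarRandom

end

/-! ### The theorem. -/

theorem mainTheorem1 {m d : ℕ} (Λ : Set (EuclideanSpace ℝ (Fin m))) (hΛ : IsCompact Λ)
    (μ : MeasureTheory.Measure Λ) [MeasureTheory.IsProbabilityMeasure μ]
    (S : OneVarRandom.HomogeneousFamily Λ d) (hS : S.UniformOSC) :
    -- convergent case
    (∀ φ : ℝ → ℝ, OneVarRandom.IsDimensionFunction φ → OneVarRandom.SumConverges φ →
      ∀ᵐ ω ∂(MeasureTheory.Measure.infinitePi fun _ : ℕ => μ),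
        ∀ ψ : ℝ → ℝ, OneVarRandom.IsDimensionFunction ψ → φ =o[𝓝[>] 0] ψ →
          OneVarRandom.HasBoxDim (S.attractor ω)
            (OneVarRandom.phiAssouadDim ψ (S.attractor ω))) ∧
    -- divergent case
    (∀ φ : ℝ → ℝ, OneVarRandom.IsDimensionFunction φ → ¬ OneVarRandom.SumConverges φ →
      ∀ᵐ ω ∂(MeasureTheory.Measure.infinitePi fun _ : ℕ => μ),
        ∀ ψ : ℝ → ℝ, OneVarRandom.IsDimensionFunction ψ →
          Tendsto (fun x => ψ x * |Real.log x|) (𝓝[>] 0) atTop →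
          ψ =o[𝓝[>] 0] φ →
            OneVarRandom.phiAssouadDim ψ (S.attractor ω) =
              OneVarRandom.assouadDim (S.attractor ω)) ∧
    -- divergent case when the almost sure Assouad dimension `sA` is attained
    ∃ sA : ℝ,
      (∀ᵐ ω ∂(MeasureTheory.Measure.infinitePi fun _ : ℕ => μ),
        OneVarRandom.assouadDim (S.attractor ω) = (sA : EReal)) ∧
      ((∃ Λ' : Set Λ, 0 < μ Λ' ∧ ∀ l ∈ Λ', S.ratioSum l sA = 1) →
        ∃ C : ℝ, 0 < C ∧ ∀ φ : ℝ → ℝ,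
          OneVarRandom.IsDimensionFunction φ → ¬ OneVarRandom.SumConverges φ →
          ∀ᵐ ω ∂(MeasureTheory.Measure.infinitePi fun _ : ℕ => μ),
            ∀ ψ : ℝ → ℝ, OneVarRandom.IsDimensionFunction ψ →
              Tendsto (fun x => ψ x * |Real.log x|) (𝓝[>] 0) atTop →
              (∀ᶠ x in 𝓝[>] 0, ψ x ≤ C * φ x) →
                OneVarRandom.phiAssouadDim ψ (S.attractor ω) =
                  OneVarRandom.assouadDim (S.attractor ω)) := by
  obtain ⟨s, hs, hupper, hlower⟩ := S.exists_essSup_exponent μ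
  have hassouad := OneVarRandom.HomogeneousFamily.ae_assouadDim_eq μ hS hs hupper hlower
  refine ⟨fun φ hφ hsum => ?_, fun φ hφ hsum => ?_, s, hassouad, ?_⟩
  · filter_upwards [OneVarRandom.HomogeneousFamily.ae_hasBoxDim_phiAssouadDim μ hS]
      with ω hω ψ hψ hφψ
    exact hω ψ fun K => OneVarRandom.eventually_mul_log_abs_log_le hφ hsum hψ hφψ K
  -- The run constants `C k` may degenerate as the exponent approaches s; ψ = o(φ) beats each of
  -- them separately.
  · choose C hC hae using fun k : ℕ =>
      OneVarRandom.HomogeneousFamily.exists_ae_le_phiAssouadDim μ hS (le_max_left _ _) (hlower k)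
    filter_upwards [hassouad, ae_all_iff.mpr hae] with ω hω hωk ψ hψ hψt hψφ
    refine le_antisymm (OneVarRandom.phiAssouadDim_le_assouadDim ψ _) ?_
    rw [hω]
    refine OneVarRandom.ereal_le_of_forall_max_sub_one_div_le fun k => ?_
    have hle : ∀ᶠ x in 𝓝[>] 0, ψ x ≤ C k * φ x := by
      obtain ⟨δ, hδ, -, hpos, -⟩ := hφ
      filter_upwards [hψφ.bound (hC k), Ioo_mem_nhdsGT hδ] with x hx hxδ
      rw [Real.norm_of_nonneg (hpos x hxδ).le] at hx
      exact (le_abs_self _).trans hx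
    obtain ⟨δ, hδ, hδ1, hfreq⟩ := hφ.frequently_le_log hsum (hC k) hψt hle
    exact hωk k ψ hψt δ hδ hδ1 hfreq
  · rintro ⟨Λ', hΛ', hone⟩
    -- The exponent s itself is now available for runs, so no limit in k is taken and one constant
    -- remains.
    have hpos : 0 < μ {l | 0 ≤ S.logRatioSum s l} := by
      refine hΛ'.trans_le (measure_mono fun l hl => ?_)
      have h1 := hone l hl
      rw [S.ratioSum_eq_exp, Real.exp_eq_one_iff] at h1
      exact h1.ge
    obtain ⟨C, hC, hae⟩ :=
      OneVarRandom.HomogeneousFamily.exists_ae_le_phiAssouadDim μ hS hs hpos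
    refine ⟨C, hC, fun φ hφ hsum => ?_⟩
    filter_upwards [hassouad, hae] with ω hω hωψ ψ hψ hψt hle
    refine le_antisymm (OneVarRandom.phiAssouadDim_le_assouadDim ψ _) ?_
    rw [hω]
    obtain ⟨δ, hδ, hδ1, hfreq⟩ := hφ.frequently_le_log hsum hC hψt hle
    exact hωψ ψ hψt δ hδ hδ1 hfreq
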